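/- Let $W$ be a standard Brownian motion, and let $\sigma>0$, $v>0$, $T>0$, $S_0,a,b\in\mathbb R$. For $\delta>0$ consider the propagator model with power-law impact $f(u)=a\,u^{\delta}$ and power-law decay kernel $G(s)=b\,s^{\delta-1}$, for an order of size $X=vT$ that is executed at the constant rate $v$ over $[0,T]$: $$S_t=S_0+\int_0^t f(v)\,G(t-s)\,ds+\sigma W_t,\qquad 0\le t\le T,$$ with cost $J=v\int_0^T S_t\,dt-XS_0$. All quantities but $\delta$ are known; $\delta$ ranges over an open parameter set $\Theta\subseteq(0,\infty)$. For an observation $Y$ whose law under the parameter $\delta$ has the Lebesgue density $p_\delta$ (positive and differentiable in $\delta$), let $\mathcal I_Y(\delta)=\mathbb E_\delta\big[(\partial_\delta\log p_\delta(Y))^2\big]$ be the Fisher information. If $\delta\in\Theta$, $\delta\le 0.8$, $0.005\le vT\le 1$ and $0.012\le t/T\le 0.222$, then the Fisher informations $\mathcal I_{(S_t,S_T)}(\delta)$ and $\mathcal I_J(\delta)$ exist, are finite, and satisfy $$\mathcal I_{(S_t,S_T)}(\delta)\ \ge\ \mathcal I_J(\delta).$$ -/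

import Mathlib

open MeasureTheory ProbabilityTheory
open scoped NNReal

noncomputable section

/-- `p` is a likelihood function of the statistical experiment `(Q θ)`, `θ ∈ Θ ⊆ ℝ`: a version of
the densities of the laws `Q θ` with respect to Lebesgue measure which is everywhere positive and,
at every sample point, differentiable in the parameter. Two such versions agree, for almost every
sample point, at all parameters of an open set `Θ`. -/
structure IsLikelihood {E : Type*} [MeasureSpace E] (Θ : Set ℝ) (Q : ℝ → Measure E)
    (p : ℝ → E → ℝ) : Prop where
  measurable : ∀ θ ∈ Θ, Measurable (p θ)
  pos : ∀ θ ∈ Θ, ∀ x, 0 < p θ x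
  law_eq : ∀ θ ∈ Θ, Q θ = (volume : Measure E).withDensity fun x => ENNReal.ofReal (p θ x)
  differentiable : ∀ x, DifferentiableOn ℝ (fun θ => p θ x) Θ

/-- The experiment `(Q θ)`, `θ ∈ Θ`, has the Fisher information `𝔼_θ[(∂_θ log p_θ(X))²] = I` at the
parameter `θ`: a likelihood function exists, and for every one of them the squared score is
integrable under `Q θ` with integral `I`. -/
def HasFisherInfo {E : Type*} [MeasureSpace E] (Θ : Set ℝ) (Q : ℝ → Measure E)
    (θ I : ℝ) : Prop :=
  (∃ p, IsLikelihood Θ Q p) ∧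
    ∀ p, IsLikelihood Θ Q p →
      Integrable (fun x => (deriv (fun η => Real.log (p η x)) θ) ^ 2) (Q θ) ∧
        ∫ x, (deriv (fun η => Real.log (p η x)) θ) ^ 2 ∂(Q θ) = I

/-- The price at time `t` in the propagator model with instantaneous impact function `f` and decay
kernel `G`, for an order executed at the constant rate `v`:
`S_t = S_0 + ∫₀ᵗ f(v) G(t - s) ds + σ W_t`. -/
def propagatorPrice {Ω : Type*} (f G : ℝ → ℝ) (v S₀ σ : ℝ) (W : ℝ≥0 → Ω → ℝ) (t : ℝ) (ω : Ω) : ℝ :=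
  S₀ + (∫ s in (0 : ℝ)..t, f v * G (t - s)) + σ * W t.toNNReal ω

/-- The cost `v ∫₀ᵀ S_t dt - X S_0` of an order of size `X = v T` executed at the constant
rate `v` over `[0, T]`, along the price path `S`. -/
def vwapCost {Ω : Type*} (v T S₀ : ℝ) (S : ℝ → Ω → ℝ) (ω : Ω) : ℝ :=
  v * (∫ t in (0 : ℝ)..T, S t ω) - v * T * S₀

/-- The propagator model with power-law impact `f(v) = a v^δ` and power-law decay
`G(s) = b s^(δ - 1)`. -/
def powerLawPrice {Ω : Type*} (a b v S₀ σ : ℝ) (W : ℝ≥0 → Ω → ℝ) (δ : ℝ) : ℝ → Ω → ℝ :=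
  propagatorPrice (fun u => a * u ^ δ) (fun s => b * s ^ (δ - 1)) v S₀ σ W

/-- The laws, indexed by `δ`, of the two price points `(S_t, S_T)`. -/
def pricePairLaw {Ω : Type*} [MeasurableSpace Ω] (P : Measure Ω) (a b v T S₀ σ : ℝ)
    (W : ℝ≥0 → Ω → ℝ) (t : ℝ) (δ : ℝ) : Measure (ℝ × ℝ) :=
  P.map fun ω => (powerLawPrice a b v S₀ σ W δ t ω, powerLawPrice a b v S₀ σ W δ T ω)

/-- The laws, indexed by `δ`, of the cost `J = v ∫₀ᵀ S_t dt - X S_0`. -/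
def vwapCostLaw {Ω : Type*} [MeasurableSpace Ω] (P : Measure Ω) (a b v T S₀ σ : ℝ)
    (W : ℝ≥0 → Ω → ℝ) (δ : ℝ) : Measure ℝ :=
  P.map (vwapCost v T S₀ (powerLawPrice a b v S₀ σ W δ))

end

/-! ### Numerical bounds for the exponential -/

/-! Both observations are Gaussian with variances free of `δ`, so each information is a squared
derivative of a mean divided by a variance. `S_t` and `S_T - S_t` are independent with variances
`σ²t` and `σ²(T - t)`, and their informations add; the noise in `J` is `vσ ∫₀ᵀ W`, of variance
`v²σ²T³/3`. Once a common factor is taken out, the claim is `normalized_info_le`, in terms of `τ =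
t/T` and `A = 1 - δ log (vT)`, which is nonnegative because `vT ≤ 1`.

With `l = -log τ` and `w = τ ^ δ`, clearing denominators leaves the nonnegativity of a quadratic
form in `A` and `R = δ` for `1.505 ≤ l ≤ 4.4229` (`quadForm_nonneg`). For `δ ≤ 0.55` all its
coefficients are nonnegative, which suffices since `A, R ≥ 0`. For larger `δ` the cross coefficient
can be negative, but the form is positive definite: the condition is `0 < infoDiscr l δ`, and
`infoDiscr` is concave in `δ` on `[0.55, 0.8]`, so that only the two endpoints need polynomial
estimates in `l`.

The Fisher information is demanded of every likelihood, but two likelihoods agree almost everywhere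
on all of `Θ` (`IsLikelihood.ae_eqOn`), so one explicit Gaussian density decides it. -/

lemma exp_le_of_taylor_pow {x c : ℝ} (k : ℕ) (hk : k ≠ 0) (hx : 0 ≤ x) (hxk : x ≤ k)
    (h : (1 + x / k + (x / k) ^ 2 / 2 + (x / k) ^ 3 / 6 + (x / k) ^ 4 / 24
      + (x / k) ^ 5 / 100) ^ k ≤ c) : Real.exp x ≤ c := by
  have hk' : (0 : ℝ) < k := by positivity
  -- For `y = x / k ≤ 1` the remainder after five terms is at most `y^5 * 6 / (5! * 5) = y^5 / 100`.
  -- Raising to the power `k` reaches arguments beyond `1` and sharpens the bound.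
  have h1 := Real.exp_bound' (x := x / k) (by positivity) ((div_le_one hk').2 hxk)
    (n := 5) (by norm_num)
  have h2 : Real.exp x = Real.exp (x / k) ^ k := by
    rw [← Real.exp_nat_mul]; congr 1; field_simp
  rw [h2]
  refine le_trans (pow_le_pow_left₀ (Real.exp_nonneg _) ?_ k) h
  refine h1.trans (le_of_eq ?_)
  simp [Finset.sum_range_succ, Nat.factorial]
  ring

lemma le_exp_of_taylor_pow {x c : ℝ} (k : ℕ) (hk : k ≠ 0) (hx : 0 ≤ x)
    (h : c ≤ (1 + x / k + (x / k) ^ 2 / 2 + (x / k) ^ 3 / 6 + (x / k) ^ 4 / 24) ^ k) :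
    c ≤ Real.exp x := by
  have h1 := Real.sum_le_exp_of_nonneg (x := x / k) (by positivity) 5
  have h2 : Real.exp x = Real.exp (x / k) ^ k := by
    rw [← Real.exp_nat_mul]; congr 1; field_simp
  rw [h2]
  refine le_trans h (pow_le_pow_left₀ (by positivity) (le_trans (le_of_eq ?_) h1) k)
  simp [Finset.sum_range_succ, Nat.factorial]

lemma exp_neg_le_of_taylor_pow {x c : ℝ} (k : ℕ) (hk : k ≠ 0) (hx : 0 ≤ x) (hc : 0 < c)
    (h : 1 / c ≤ (1 + x / k + (x / k) ^ 2 / 2 + (x / k) ^ 3 / 6 + (x / k) ^ 4 / 24) ^ k) :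
    Real.exp (-x) ≤ c := by
  have := le_exp_of_taylor_pow k hk hx h
  rw [Real.exp_neg]
  exact (inv_le_comm₀ (Real.exp_pos _) hc).2 (by simpa using this)

lemma le_exp_neg_of_taylor_pow {x c : ℝ} (k : ℕ) (hk : k ≠ 0) (hx : 0 ≤ x) (hxk : x ≤ k)
    (hc : 0 < c)
    (h : (1 + x / k + (x / k) ^ 2 / 2 + (x / k) ^ 3 / 6 + (x / k) ^ 4 / 24
      + (x / k) ^ 5 / 100) ^ k ≤ 1 / c) : c ≤ Real.exp (-x) := by
  have := exp_le_of_taylor_pow k hk hx hxk h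
  rw [Real.exp_neg]
  exact (le_inv_comm₀ hc (Real.exp_pos _)).2 (by simpa using this)

/-- If `P` is the Taylor polynomial of degree four, then `P(-x) P(x) = 1 + x^6/72 + x^8/576 ≥ 1`, so
`exp (-x) ≤ 1 / P(x) ≤ P(-x)`. The quadratic version below works the same way. -/
lemma exp_neg_le_quartic {x : ℝ} (hx : 0 ≤ x) :
    Real.exp (-x) ≤ 1 - x + x ^ 2 / 2 - x ^ 3 / 6 + x ^ 4 / 24 := by
  have h1 : 1 + x + x ^ 2 / 2 + x ^ 3 / 6 + x ^ 4 / 24 ≤ Real.exp x :=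
    le_exp_of_taylor_pow 1 one_ne_zero hx (by simp)
  have h2 : 0 < 1 + x + x ^ 2 / 2 + x ^ 3 / 6 + x ^ 4 / 24 := by positivity
  have h3 : 1 ≤ (1 - x + x ^ 2 / 2 - x ^ 3 / 6 + x ^ 4 / 24) *
      (1 + x + x ^ 2 / 2 + x ^ 3 / 6 + x ^ 4 / 24) := by
    have : (1 - x + x ^ 2 / 2 - x ^ 3 / 6 + x ^ 4 / 24) *
      (1 + x + x ^ 2 / 2 + x ^ 3 / 6 + x ^ 4 / 24) = 1 + x ^ 6 / 72 + x ^ 8 / 576 := by ring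
    rw [this]
    have : 0 ≤ x ^ 6 / 72 + x ^ 8 / 576 := by positivity
    linarith
  have h4 : 0 < 1 - x + x ^ 2 / 2 - x ^ 3 / 6 + x ^ 4 / 24 :=
    pos_of_mul_pos_left (lt_of_lt_of_le one_pos h3) h2.le
  rw [Real.exp_neg, inv_le_comm₀ (Real.exp_pos _) h4]
  calc _ ≤ 1 + x + x ^ 2 / 2 + x ^ 3 / 6 + x ^ 4 / 24 := by
        rw [inv_le_iff_one_le_mul₀ h4]; linarith
    _ ≤ _ := h1

lemma exp_neg_le_quadratic {x : ℝ} (hx : 0 ≤ x) : Real.exp (-x) ≤ 1 - x + x ^ 2 / 2 := by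
  have h1 : 1 + x + x ^ 2 / 2 ≤ Real.exp x := Real.quadratic_le_exp_of_nonneg hx
  have h4 : 0 < 1 - x + x ^ 2 / 2 := by nlinarith [sq_nonneg (x - 1)]
  rw [Real.exp_neg, inv_le_comm₀ (Real.exp_pos _) h4]
  refine le_trans ?_ h1
  rw [inv_le_iff_one_le_mul₀ h4]
  have : (1 + x + x ^ 2 / 2) * (1 - x + x ^ 2 / 2) = 1 + (x ^ 2 / 2) ^ 2 := by ring
  rw [this]
  nlinarith [sq_nonneg (x ^ 2)]

/-- One numerical value at an endpoint becomes a polynomial bound on an interval. The decreasing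
exponential is anchored on the left and, below, the increasing one on the right, so that the
residual exponent is never positive. -/
lemma exp_le_of_exp_le_left {r a l c : ℝ} (hr : 0 ≤ r) (ha : Real.exp (-(r * a)) ≤ c)
    (hl : a ≤ l) :
    Real.exp (-(r * l)) ≤ c * (1 - r * (l - a) + (r * (l - a)) ^ 2 / 2) := by
  have : -(r * l) = -(r * a) + -(r * (l - a)) := by ring
  rw [this, Real.exp_add]
  exact mul_le_mul ha (exp_neg_le_quadratic (mul_nonneg hr (sub_nonneg.2 hl))) (Real.exp_nonneg _)
    ((Real.exp_nonneg _).trans ha)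

lemma exp_le_of_exp_le_right {r b l c : ℝ} (hr : 0 ≤ r) (hb : Real.exp (r * b) ≤ c)
    (hl : l ≤ b) :
    Real.exp (r * l) ≤ c * (1 - r * (b - l) + (r * (b - l)) ^ 2 / 2
      - (r * (b - l)) ^ 3 / 6 + (r * (b - l)) ^ 4 / 24) := by
  have : r * l = r * b + -(r * (b - l)) := by ring
  rw [this, Real.exp_add]
  exact mul_le_mul hb (exp_neg_le_quartic (mul_nonneg hr (sub_nonneg.2 hl))) (Real.exp_nonneg _)
    ((Real.exp_nonneg _).trans hb)

/-! ### The two extreme exponents of the upper range -/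

/-- The discriminant, up to a positive factor, of the quadratic form comparing the two
Fisher informations. -/
noncomputable def infoDiscr (l δ : ℝ) : ℝ :=
  (1 + δ) ^ 4 * l ^ 2 - 3 * (((1 + δ) * l - 1) ^ 2
    + 2 * ((1 + δ) * l - 1) * Real.exp (-((1 - δ) * l)) + Real.exp ((2 * δ - 1) * l))

/-- The Bernstein polynomials of degree four for `[a, b]` are nonnegative there. -/
lemma nonneg_bernstein_quartic {a b l : ℝ} (h1 : a ≤ l) (h2 : l ≤ b) :
    0 ≤ (b - l) ^ 4 ∧ 0 ≤ (l - a) * (b - l) ^ 3 ∧ 0 ≤ (l - a) ^ 2 * (b - l) ^ 2 ∧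
      0 ≤ (l - a) ^ 3 * (b - l) ∧ 0 ≤ (l - a) ^ 4 := by
  have h3 := sub_nonneg.2 h1
  have h4 := sub_nonneg.2 h2
  refine ⟨?_, ?_, ?_, ?_, ?_⟩ <;> positivity

/-- Both exponentials enter `infoDiscr` with a nonpositive coefficient, so upper bounds on them
suffice. -/
lemma infoDiscr_pos_of_bounds {l δ u E : ℝ} (hs : 0 ≤ (1 + δ) * l - 1)
    (hu : Real.exp (-((1 - δ) * l)) ≤ u) (hE : Real.exp ((2 * δ - 1) * l) ≤ E)
    (h : 0 < (1 + δ) ^ 4 * l ^ 2 - 3 * (((1 + δ) * l - 1) ^ 2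
      + 2 * ((1 + δ) * l - 1) * u + E)) : 0 < infoDiscr l δ := by
  have := mul_le_mul_of_nonneg_left hu hs
  unfold infoDiscr
  linarith

/-- The rates are `1 - δ = 0.2` and `2δ - 1 = 0.6`. The exponential bounds leave a polynomial of
degree four in `l`, which is compared with the Bernstein basis; the range of `l` is cut in three
because the expansions are accurate only near their anchors. -/
lemma infoDiscr_upper_pos_left {l : ℝ} (h1 : 1.505 ≤ l) (h2 : l ≤ 2.5) : 0 < infoDiscr l 0.8 := by
  have hc : Real.exp (-(0.2 * 1.505)) ≤ 0.74009 :=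
    exp_neg_le_of_taylor_pow 8 (by norm_num) (by norm_num) (by norm_num) (by norm_num)
  have hC : Real.exp (0.6 * 2.5) ≤ 4.4817 :=
    exp_le_of_taylor_pow 16 (by norm_num) (by norm_num) (by norm_num) (by norm_num)
  have hu := exp_le_of_exp_le_left (by norm_num) hc h1
  have hE := exp_le_of_exp_le_right (by norm_num) hC h2
  obtain ⟨b0, b1, b2, b3, b4⟩ := nonneg_bernstein_quartic h1 h2
  refine infoDiscr_pos_of_bounds (by linarith)
    (le_trans (le_of_eq (by norm_num)) hu) (le_trans (le_of_eq (by norm_num)) hE) ?_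
  nlinarith only [b0, b1, b2, b3, b4]

lemma infoDiscr_upper_pos_mid {l : ℝ} (h1 : 2.5 ≤ l) (h2 : l ≤ 3.5) : 0 < infoDiscr l 0.8 := by
  have hc : Real.exp (-(0.2 * 2.5)) ≤ 0.60655 :=
    exp_neg_le_of_taylor_pow 8 (by norm_num) (by norm_num) (by norm_num) (by norm_num)
  have hC : Real.exp (0.6 * 3.5) ≤ 8.16618 :=
    exp_le_of_taylor_pow 16 (by norm_num) (by norm_num) (by norm_num) (by norm_num)
  have hu := exp_le_of_exp_le_left (by norm_num) hc h1
  have hE := exp_le_of_exp_le_right (by norm_num) hC h2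
  obtain ⟨b0, b1, b2, b3, b4⟩ := nonneg_bernstein_quartic h1 h2
  refine infoDiscr_pos_of_bounds (by linarith)
    (le_trans (le_of_eq (by norm_num)) hu) (le_trans (le_of_eq (by norm_num)) hE) ?_
  nlinarith only [b0, b1, b2, b3, b4]

lemma infoDiscr_upper_pos_right {l : ℝ} (h1 : 3.5 ≤ l) (h2 : l ≤ 4.4229) : 0 < infoDiscr l 0.8 := by
  have hc : Real.exp (-(0.2 * 3.5)) ≤ 0.4966 :=
    exp_neg_le_of_taylor_pow 8 (by norm_num) (by norm_num) (by norm_num) (by norm_num)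
  have hC : Real.exp (0.6 * 4.4229) ≤ 14.208 :=
    exp_le_of_taylor_pow 16 (by norm_num) (by norm_num) (by norm_num) (by norm_num)
  have hu := exp_le_of_exp_le_left (by norm_num) hc h1
  have hE := exp_le_of_exp_le_right (by norm_num) hC h2
  obtain ⟨b0, b1, b2, b3, b4⟩ := nonneg_bernstein_quartic h1 h2
  refine infoDiscr_pos_of_bounds (by linarith)
    (le_trans (le_of_eq (by norm_num)) hu) (le_trans (le_of_eq (by norm_num)) hE) ?_
  nlinarith only [b0, b1, b2, b3, b4]

lemma infoDiscr_upper_pos {l : ℝ} (h1 : 1.505 ≤ l) (h2 : l ≤ 4.4229) : 0 < infoDiscr l 0.8 := by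
  rcases le_total l 2.5 with h | h
  · exact infoDiscr_upper_pos_left h1 h
  rcases le_total l 3.5 with h' | h'
  · exact infoDiscr_upper_pos_mid h h'
  · exact infoDiscr_upper_pos_right h' h2

lemma infoDiscr_lower_pos_left {l : ℝ} (h1 : 1.505 ≤ l) (h2 : l ≤ 2.5) : 0 < infoDiscr l 0.55 := by
  have hc : Real.exp (-(0.45 * 1.505)) ≤ 0.50803 :=
    exp_neg_le_of_taylor_pow 8 (by norm_num) (by norm_num) (by norm_num) (by norm_num)
  have hC : Real.exp (0.1 * 2.5) ≤ 1.28404 :=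
    exp_le_of_taylor_pow 16 (by norm_num) (by norm_num) (by norm_num) (by norm_num)
  have hu := exp_le_of_exp_le_left (by norm_num) hc h1
  have hE := exp_le_of_exp_le_right (by norm_num) hC h2
  obtain ⟨b0, b1, b2, b3, b4⟩ := nonneg_bernstein_quartic h1 h2
  refine infoDiscr_pos_of_bounds (by linarith)
    (le_trans (le_of_eq (by norm_num)) hu) (le_trans (le_of_eq (by norm_num)) hE) ?_
  nlinarith only [b0, b1, b2, b3, b4]

lemma infoDiscr_lower_pos_mid {l : ℝ} (h1 : 2.5 ≤ l) (h2 : l ≤ 3.5) : 0 < infoDiscr l 0.55 := by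
  have hc : Real.exp (-(0.45 * 2.5)) ≤ 0.32467 :=
    exp_neg_le_of_taylor_pow 8 (by norm_num) (by norm_num) (by norm_num) (by norm_num)
  have hC : Real.exp (0.1 * 3.5) ≤ 1.41908 :=
    exp_le_of_taylor_pow 16 (by norm_num) (by norm_num) (by norm_num) (by norm_num)
  have hu := exp_le_of_exp_le_left (by norm_num) hc h1
  have hE := exp_le_of_exp_le_right (by norm_num) hC h2
  obtain ⟨b0, b1, b2, b3, b4⟩ := nonneg_bernstein_quartic h1 h2
  refine infoDiscr_pos_of_bounds (by linarith)
    (le_trans (le_of_eq (by norm_num)) hu) (le_trans (le_of_eq (by norm_num)) hE) ?_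
  nlinarith only [b0, b1, b2, b3, b4]

lemma infoDiscr_lower_pos_right {l : ℝ} (h1 : 3.5 ≤ l) (h2 : l ≤ 4.4229) : 0 < infoDiscr l 0.55 := by
  have hc : Real.exp (-(0.45 * 3.5)) ≤ 0.20702 :=
    exp_neg_le_of_taylor_pow 8 (by norm_num) (by norm_num) (by norm_num) (by norm_num)
  have hC : Real.exp (0.1 * 4.4229) ≤ 1.55628 :=
    exp_le_of_taylor_pow 16 (by norm_num) (by norm_num) (by norm_num) (by norm_num)
  have hu := exp_le_of_exp_le_left (by norm_num) hc h1
  have hE := exp_le_of_exp_le_right (by norm_num) hC h2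
  obtain ⟨b0, b1, b2, b3, b4⟩ := nonneg_bernstein_quartic h1 h2
  refine infoDiscr_pos_of_bounds (by linarith)
    (le_trans (le_of_eq (by norm_num)) hu) (le_trans (le_of_eq (by norm_num)) hE) ?_
  nlinarith only [b0, b1, b2, b3, b4]

lemma infoDiscr_lower_pos {l : ℝ} (h1 : 1.505 ≤ l) (h2 : l ≤ 4.4229) : 0 < infoDiscr l 0.55 := by
  rcases le_total l 2.5 with h | h
  · exact infoDiscr_lower_pos_left h1 h
  rcases le_total l 3.5 with h' | h'
  · exact infoDiscr_lower_pos_mid h h'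
  · exact infoDiscr_lower_pos_right h' h2

/-! ### Concavity of the discriminant in the exponent -/

/-- This is the inequality of `discr_curvature` at `δ = 0.55`, divided by `6`, with `exp (0.1 * l)`
replaced by its quadratic Taylor bound. -/
lemma discr_curvature_lower {l : ℝ} (h1 : 1.505 ≤ l) (h2 : l ≤ 4.4229) :
    1.805 - 0.2 * l - 0.01 * l ^ 2 ≤ (1.55 * l + 1) * Real.exp (-(0.45 * l)) := by
  have hc : 0.3011 ≤ Real.exp (-1.2) :=
    le_exp_neg_of_taylor_pow 4 (by norm_num) (by norm_num) (by norm_num) (by norm_num)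
      (by norm_num)
  -- A squared tangent line, touching at `l = 8/3`, stays positive on the whole range and leaves a
  -- cubic to check.
  have hr : 1.6 - 0.225 * l ≤ Real.exp (0.6 - 0.225 * l) := by
    have := Real.add_one_le_exp (0.6 - 0.225 * l); linarith
  have hE : Real.exp (-(0.45 * l)) = Real.exp (-1.2) * Real.exp (0.6 - 0.225 * l) ^ 2 := by
    rw [← Real.exp_nat_mul, ← Real.exp_add]; congr 1; push_cast; ring
  have h3 : 0.3011 * (1.6 - 0.225 * l) ^ 2 ≤ Real.exp (-(0.45 * l)) := by
    rw [hE]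
    exact mul_le_mul hc (pow_le_pow_left₀ (by linarith) hr 2) (sq_nonneg _) (Real.exp_nonneg _)
  refine le_trans ?_ (mul_le_mul_of_nonneg_left h3 (by linarith : (0 : ℝ) ≤ 1.55 * l + 1))
  have ha := sub_nonneg.2 h1
  have hb := sub_nonneg.2 h2
  have b0 := pow_nonneg hb 3
  have b1 := mul_nonneg ha (pow_nonneg hb 2)
  have b2 := mul_nonneg (pow_nonneg ha 2) hb
  have b3 := pow_nonneg ha 3
  nlinarith only [b0, b1, b2, b3]

lemma discr_curvature {l δ : ℝ} (h1 : 1.505 ≤ l) (h2 : l ≤ 4.4229) (hδ : 0.55 ≤ δ)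
    (hδ' : δ ≤ 0.8) :
    12 * (1 + δ) ^ 2 - 6 ≤ 6 * Real.exp (-((1 - δ) * l)) * ((1 + δ) * l + 1)
      + 12 * Real.exp ((2 * δ - 1) * l) := by
  have hu : Real.exp (-(0.45 * l)) ≤ Real.exp (-((1 - δ) * l)) :=
    Real.exp_le_exp.2 (by nlinarith)
  have hy : 1.55 * l + 1 ≤ (1 + δ) * l + 1 := by nlinarith
  have huy : Real.exp (-(0.45 * l)) * (1.55 * l + 1)
      ≤ Real.exp (-((1 - δ) * l)) * ((1 + δ) * l + 1) :=
    mul_le_mul hu hy (by linarith) (Real.exp_nonneg _)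
  have hE0 : 1 + 0.1 * l + (0.1 * l) ^ 2 / 2 ≤ Real.exp (0.1 * l) :=
    Real.quadratic_le_exp_of_nonneg (by linarith)
  have hE : Real.exp (0.1 * l) * (1 + 2 * (δ - 0.55) * l) ≤ Real.exp ((2 * δ - 1) * l) := by
    have : (2 * δ - 1) * l = 0.1 * l + 2 * (δ - 0.55) * l := by ring
    rw [this, Real.exp_add]
    refine mul_le_mul_of_nonneg_left ?_ (Real.exp_nonneg _)
    have := Real.add_one_le_exp (2 * (δ - 0.55) * l)
    linarith
  have hlow := discr_curvature_lower h1 h2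
  -- `3.35 = 1.55 + 1.8` is the slope of the chord of `(1 + δ)^2` over `[0.55, 0.8]`, which lies
  -- above this convex function.
  have hslope : 0 ≤ (δ - 0.55) * (2 * l * Real.exp (0.1 * l) - 3.35) := by
    refine mul_nonneg (by linarith) ?_
    nlinarith [mul_le_mul_of_nonneg_left hE0 (by linarith : (0 : ℝ) ≤ l)]
  nlinarith

lemma concaveOn_infoDiscr {l : ℝ} (h1 : 1.505 ≤ l) (h2 : l ≤ 4.4229) :
    ConcaveOn ℝ (Set.Icc 0.55 0.8) (infoDiscr l) := by
  have hn (δ : ℝ) : HasDerivAt (fun δ => (1 + δ)) 1 δ := (hasDerivAt_id δ).const_add 1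
  have hs (δ : ℝ) : HasDerivAt (fun δ => (1 + δ) * l - 1) l δ := by
    simpa using ((hn δ).mul_const l).sub_const 1
  have hu (δ : ℝ) : HasDerivAt (fun δ => Real.exp (-((1 - δ) * l)))
      (l * Real.exp (-((1 - δ) * l))) δ := by
    have : HasDerivAt (fun δ => -((1 - δ) * l)) l δ := by
      exact (((hasDerivAt_id δ).const_sub 1).mul_const l).neg.congr_deriv (by ring)
    simpa [mul_comm] using this.exp
  have hE (δ : ℝ) : HasDerivAt (fun δ => Real.exp ((2 * δ - 1) * l))
      (2 * l * Real.exp ((2 * δ - 1) * l)) δ := by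
    have : HasDerivAt (fun δ => (2 * δ - 1) * l) (2 * l) δ := by
      simpa using ((((hasDerivAt_id δ).const_mul 2).sub_const 1).mul_const l)
    simpa [mul_comm] using this.exp
  refine concaveOn_of_hasDerivWithinAt2_nonpos (convex_Icc _ _)
    -- With `s = (1 + δ) * l - 1` and `u = exp (-((1 - δ) * l))`, both `s' = l` and `u' = l * u`, so
    -- `(s * u)' = l * (s + 1) * u`.
    (f' := fun δ => 4 * (1 + δ) ^ 3 * l ^ 2 - 6 * l * ((1 + δ) * l - 1
      + ((1 + δ) * l - 1 + 1) * Real.exp (-((1 - δ) * l)) + Real.exp ((2 * δ - 1) * l)))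
    (f'' := fun δ => l ^ 2 * (12 * (1 + δ) ^ 2 - 6 - 6 * Real.exp (-((1 - δ) * l)) *
      ((1 + δ) * l + 1) - 12 * Real.exp ((2 * δ - 1) * l))) ?_ ?_ ?_ ?_
  · unfold infoDiscr; fun_prop
  · intro δ _
    have := (((hn δ).pow 4).mul_const (l ^ 2)).sub (((((hs δ).pow 2).add
      (((hs δ).const_mul 2).mul (hu δ))).add (hE δ)).const_mul 3)
    refine (this.congr_deriv ?_).hasDerivWithinAt
    push_cast; ring
  · intro δ _
    have := ((((hn δ).pow 3).const_mul 4).mul_const (l ^ 2)).sub ((((hs δ).add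
      (((hs δ).add_const 1).mul (hu δ))).add (hE δ)).const_mul (6 * l))
    refine (this.congr_deriv ?_).hasDerivWithinAt
    push_cast; ring
  · intro δ hδ
    rw [interior_Icc] at hδ
    have := discr_curvature h1 h2 hδ.1.le hδ.2.le
    exact mul_nonpos_of_nonneg_of_nonpos (sq_nonneg l) (by linarith)

lemma infoDiscr_pos {l δ : ℝ} (h1 : 1.505 ≤ l) (h2 : l ≤ 4.4229) (hδ : 0.55 ≤ δ)
    (hδ' : δ ≤ 0.8) : 0 < infoDiscr l δ :=
  lt_of_lt_of_le (lt_min (infoDiscr_lower_pos h1 h2) (infoDiscr_upper_pos h1 h2))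
    ((concaveOn_infoDiscr h1 h2).min_le_of_mem_Icc (by norm_num) (by norm_num) ⟨hδ, hδ'⟩)

/-! ### The coefficients of the quadratic form for small exponents -/

/-- The case `δ = 0.55` of `cross_coeff_nonneg`. It is nearly sharp at `l = 1.505` (about `2.33`
against `2.37`), so all exponentials are expanded there; beyond `l = 2` the term `exp (-l)` can be
dropped. -/
lemma cross_coeff_at_upper {l : ℝ} (h1 : 1.505 ≤ l) (h2 : l ≤ 4.4229) :
    3 * (1 - Real.exp (-l)) ≤
      1.55 ^ 3 * l * (Real.exp (-(0.1 * l)) * (1 - Real.exp (-(0.45 * l)))) := by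
  have hprod : Real.exp (-(0.1 * l)) * (1 - Real.exp (-(0.45 * l)))
      = Real.exp (-(0.1 * l)) - Real.exp (-(0.55 * l)) := by
    rw [mul_sub, mul_one, ← Real.exp_add]; congr 2; ring
  rw [hprod]
  rcases le_total l 2 with h | h
  · have c1 : 0.8602 ≤ Real.exp (-(0.1 * 1.505)) :=
      le_exp_neg_of_taylor_pow 4 (by norm_num) (by norm_num) (by norm_num) (by norm_num)
        (by norm_num)
    have c2 : Real.exp (-(0.55 * 1.505)) ≤ 0.4371 :=
      exp_neg_le_of_taylor_pow 4 (by norm_num) (by norm_num) (by norm_num) (by norm_num)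
    have c3 : 0.222 ≤ Real.exp (-1.505) :=
      le_exp_neg_of_taylor_pow 8 (by norm_num) (by norm_num) (by norm_num) (by norm_num)
        (by norm_num)
    have e1 : 0.8602 * (1 - 0.1 * (l - 1.505)) ≤ Real.exp (-(0.1 * l)) := by
      have : -(0.1 * l) = -(0.1 * 1.505) + -(0.1 * (l - 1.505)) := by ring
      rw [this, Real.exp_add]
      exact mul_le_mul c1 (Real.one_sub_le_exp_neg _) (by linarith) (Real.exp_nonneg _)
    have e2 := exp_le_of_exp_le_left (by norm_num) c2 h1
    have e3 : 0.222 * (1 - (l - 1.505)) ≤ Real.exp (-l) := by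
      have : -l = -1.505 + -(l - 1.505) := by ring
      rw [this, Real.exp_add]
      exact mul_le_mul c3 (Real.one_sub_le_exp_neg _) (by linarith) (Real.exp_nonneg _)
    have e4 : 0.423 + 0.1 * (l - 1.505) ≤ Real.exp (-(0.1 * l)) - Real.exp (-(0.55 * l)) := by
      nlinarith
    have e5 := mul_le_mul_of_nonneg_left e4 (by linarith : (0 : ℝ) ≤ 1.55 ^ 3 * l)
    nlinarith
  · have c2 : Real.exp (-(0.55 * 2)) ≤ 0.333 :=
      exp_neg_le_of_taylor_pow 4 (by norm_num) (by norm_num) (by norm_num) (by norm_num)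
    have e1 : 1 - 0.1 * l ≤ Real.exp (-(0.1 * l)) := Real.one_sub_le_exp_neg _
    have e2 : Real.exp (-(0.55 * l)) ≤ 0.333 :=
      (Real.exp_le_exp.2 (by linarith)).trans c2
    have e3 := Real.exp_pos (-l)
    have e4 : 0.667 - 0.1 * l ≤ Real.exp (-(0.1 * l)) - Real.exp (-(0.55 * l)) := by linarith
    have e5 := mul_le_mul_of_nonneg_left e4 (by linarith : (0 : ℝ) ≤ 1.55 ^ 3 * l)
    nlinarith

/-- The right-hand side is at least its value at `δ = 0.55`: the factor `exp (2 * (0.55 - δ) * l)`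
makes up for the decrease of `(1 + δ) ^ 3`, because `2 * l ≥ 3` and `(1 + δ) * (1.55 - δ) ≥ 1.55`.
-/
lemma cross_coeff_nonneg {l δ : ℝ} (h1 : 1.505 ≤ l) (h2 : l ≤ 4.4229) (hδ : 0 < δ)
    (hδ' : δ ≤ 0.55) :
    3 * (1 - Real.exp (-l)) ≤
      (1 + δ) ^ 3 * l * (Real.exp ((1 - 2 * δ) * l) - Real.exp (-(δ * l))) := by
  have hD : Real.exp ((1 - 2 * δ) * l) - Real.exp (-(δ * l)) = Real.exp (2 * (0.55 - δ) * l) *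
      (Real.exp (-(0.1 * l)) * (1 - Real.exp (-((1 - δ) * l)))) := by
    rw [mul_one_sub, mul_sub, ← Real.exp_add, ← Real.exp_add, ← Real.exp_add]
    congr 2 <;> ring
  have hk : (1 + δ) * (1 + (0.55 - δ)) ≤ (1 + δ) * Real.exp (0.55 - δ) := by
    have := Real.add_one_le_exp (0.55 - δ)
    exact mul_le_mul_of_nonneg_left (by linarith) (by linarith)
  have hcube : 1.55 ^ 3 ≤ (1 + δ) ^ 3 * Real.exp (2 * (0.55 - δ) * l) := by
    have e1 : Real.exp (0.55 - δ) ^ 3 ≤ Real.exp (2 * (0.55 - δ) * l) := by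
      rw [← Real.exp_nat_mul]
      refine Real.exp_le_exp.2 ?_
      push_cast; nlinarith
    have e2 : (1.55 : ℝ) ^ 3 ≤ ((1 + δ) * Real.exp (0.55 - δ)) ^ 3 :=
      pow_le_pow_left₀ (by norm_num) (by nlinarith) 3
    rw [mul_pow] at e2
    exact e2.trans (mul_le_mul_of_nonneg_left e1 (by positivity))
  have hmono : 1 - Real.exp (-(0.45 * l)) ≤ 1 - Real.exp (-((1 - δ) * l)) :=
    sub_le_sub_left (Real.exp_le_exp.2 (by nlinarith)) 1
  have hpos : 0 ≤ 1 - Real.exp (-(0.45 * l)) :=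
    sub_nonneg.2 (Real.exp_le_one_iff.2 (by linarith))
  refine (cross_coeff_at_upper h1 h2).trans ?_
  rw [hD]
  have hl : 0 ≤ l := by linarith
  calc 1.55 ^ 3 * l * (Real.exp (-(0.1 * l)) * (1 - Real.exp (-(0.45 * l))))
      ≤ (1 + δ) ^ 3 * Real.exp (2 * (0.55 - δ) * l) * l *
        (Real.exp (-(0.1 * l)) * (1 - Real.exp (-((1 - δ) * l)))) := by gcongr
    _ = _ := by ring

lemma exp_neg_half_le {l : ℝ} (h1 : 1.505 ≤ l) : Real.exp (-(0.5 * l)) ≤ 0.4713 := by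
  have : Real.exp (-(0.5 * 1.505)) ≤ 0.4713 :=
    exp_neg_le_of_taylor_pow 4 (by norm_num) (by norm_num) (by norm_num) (by norm_num)
  exact (Real.exp_le_exp.2 (by linarith)).trans this

lemma exp_neg_half_le_affine {l : ℝ} (h1 : 1.505 ≤ l) (h2 : l ≤ 4.4229) :
    Real.exp (-(0.5 * l)) ≤ 0.6 - 0.08 * l := by
  rcases le_total l 3 with h | h
  · have := exp_le_of_exp_le_left (by norm_num) (exp_neg_half_le le_rfl) h1
    refine this.trans ?_
    nlinarith
  · have : Real.exp (-(0.5 * 3)) ≤ 0.2232 :=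
      exp_neg_le_of_taylor_pow 8 (by norm_num) (by norm_num) (by norm_num) (by norm_num)
    have h3 : Real.exp (-(0.5 * l)) ≤ Real.exp (-(0.5 * 3)) := Real.exp_le_exp.2 (by linarith)
    linarith

lemma exp_neg_eq_half_sq (l : ℝ) : Real.exp (-l) = Real.exp (-(0.5 * l)) ^ 2 := by
  rw [← Real.exp_nat_mul]; congr 1; push_cast; ring

/-- With `p = exp (-l/2)` and `y = exp ((0.5 - δ) * l)` the bracket is `(y - p)^2 + 1 - p^2`, and `1
- exp (-l) = (1 - p) * (1 + p)`. Bounding `y` below by its Taylor polynomial makes the factor `1 -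
p` cancel. -/
lemma square_coeff_nonneg_of_le_half {l δ : ℝ} (h1 : 1.505 ≤ l) (hδ : 0 < δ) (hδ' : δ ≤ 0.5) :
    3 * (1 - Real.exp (-l)) ≤
      (1 + δ) ^ 2 * (1 - 2 * Real.exp (-(δ * l)) + Real.exp ((1 - 2 * δ) * l)) := by
  have hp := exp_neg_half_le h1
  have hp0 := Real.exp_pos (-(0.5 * l))
  rw [exp_neg_eq_half_sq l]
  set p := Real.exp (-(0.5 * l))
  set z := (0.5 - δ) * l with hz
  have hz0 : 0 ≤ z := mul_nonneg (by linarith) (by linarith)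
  have hy : 1 + z + z ^ 2 / 2 ≤ Real.exp z := Real.quadratic_le_exp_of_nonneg hz0
  have hw : Real.exp (-(δ * l)) = p * Real.exp z := by
    rw [← Real.exp_add, hz]; congr 1; ring
  have hw2 : Real.exp ((1 - 2 * δ) * l) = Real.exp z ^ 2 := by
    rw [← Real.exp_nat_mul, hz]; congr 1; push_cast; ring
  rw [hw, hw2]
  set y := Real.exp z
  have hzx : 0.7525 * (1 - 2 * δ) ≤ z := by rw [hz]; nlinarith
  have hsq : (1 - p) * (2 + 2 * z + 2 * z ^ 2) ≤ 1 - 2 * (p * y) + y ^ 2 := by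
    have : (1 - p + z + z ^ 2 / 2) ^ 2 ≤ (y - p) ^ 2 :=
      pow_le_pow_left₀ (by nlinarith [sq_nonneg z]) (by linarith) 2
    nlinarith [mul_nonneg hp0.le (sq_nonneg z), mul_nonneg hz0 (sq_nonneg z),
      sq_nonneg (z ^ 2)]
  -- `4.4139 = 3 * (1 + 0.4713)` bounds `3 * (1 + p)`.
  have hpoly : 4.4139 ≤ (1 + δ) ^ 2 * (2 + 2 * z + 2 * z ^ 2) := by
    have e1 : 2 + 2 * (0.7525 * (1 - 2 * δ)) + 2 * (0.7525 * (1 - 2 * δ)) ^ 2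
        ≤ 2 + 2 * z + 2 * z ^ 2 := by
      have := pow_le_pow_left₀ (by linarith : 0 ≤ 0.7525 * (1 - 2 * δ)) hzx 2
      linarith
    refine le_trans ?_ (mul_le_mul_of_nonneg_left e1 (sq_nonneg (1 + δ)))
    have ha : 0 ≤ 0.5 - δ := by linarith
    have b0 := pow_nonneg hδ.le 4
    have b1 := mul_nonneg (pow_nonneg hδ.le 3) ha
    have b2 := mul_nonneg (pow_nonneg hδ.le 2) (pow_nonneg ha 2)
    have b3 := mul_nonneg hδ.le (pow_nonneg ha 3)
    have b4 := pow_nonneg ha 4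
    nlinarith only [b0, b1, b2, b3, b4]
  calc 3 * (1 - p ^ 2) = (1 - p) * (3 * (1 + p)) := by ring
    _ ≤ (1 - p) * ((1 + δ) ^ 2 * (2 + 2 * z + 2 * z ^ 2)) :=
        mul_le_mul_of_nonneg_left (by linarith) (by linarith)
    _ = (1 + δ) ^ 2 * ((1 - p) * (2 + 2 * z + 2 * z ^ 2)) := by ring
    _ ≤ _ := mul_le_mul_of_nonneg_left hsq (sq_nonneg _)

/-- Now `z ≤ 0`, and `1 - 2py + y^2 = (y - 1)^2 + 2(1 - p)y` again yields a factor `1 - p`. -/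
lemma square_coeff_nonneg_of_half_le {l δ : ℝ} (h1 : 1.505 ≤ l) (h2 : l ≤ 4.4229)
    (hδ : 0.5 ≤ δ) (hδ' : δ ≤ 0.55) :
    3 * (1 - Real.exp (-l)) ≤
      (1 + δ) ^ 2 * (1 - 2 * Real.exp (-(δ * l)) + Real.exp ((1 - 2 * δ) * l)) := by
  have hp := exp_neg_half_le h1
  have hpl := exp_neg_half_le_affine h1 h2
  have hp0 := Real.exp_pos (-(0.5 * l))
  rw [exp_neg_eq_half_sq l]
  set p := Real.exp (-(0.5 * l))
  set z := (0.5 - δ) * l with hz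
  have hy : 1 + z ≤ Real.exp z := by linarith [Real.add_one_le_exp z]
  have hw : Real.exp (-(δ * l)) = p * Real.exp z := by
    rw [← Real.exp_add, hz]; congr 1; ring
  have hw2 : Real.exp ((1 - 2 * δ) * l) = Real.exp z ^ 2 := by
    rw [← Real.exp_nat_mul, hz]; congr 1; push_cast; ring
  rw [hw, hw2]
  set y := Real.exp z
  have hsq : (1 - p) * (2 + 2 * z) ≤ 1 - 2 * (p * y) + y ^ 2 := by
    nlinarith [sq_nonneg (y - 1), mul_nonneg (by linarith : 0 ≤ 1 - p) (sub_nonneg.2 hy)]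
  have hpoly : 3 * (1 + p) ≤ (1 + δ) ^ 2 * (2 + 2 * z) := by
    have hx : 0 ≤ δ - 0.5 := by linarith
    -- With `(1 + δ)^2` replaced by its tangent at `0.5`, the difference of the two sides is concave
    -- in `δ`. `e1` and `e2` encode its signs at `0.5` and `0.55`; `e5` is its excess over the
    -- chord.
    have e1 : 0 ≤ (0.55 - δ) * (1.5 - 3 * p) := mul_nonneg (by linarith) (by linarith)
    have e2 : 0 ≤ (δ - 0.5) * (0.6 - 0.08 * l - p) := mul_nonneg hx (by linarith)
    have e3 : 0 ≤ 2 + 2 * z := by rw [hz]; nlinarith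
    have e4 : (2.25 + 3 * (δ - 0.5)) * (2 + 2 * z) ≤ (1 + δ) ^ 2 * (2 + 2 * z) :=
      mul_le_mul_of_nonneg_right (by nlinarith) e3
    have e5 : 0 ≤ (δ - 0.5) * (0.55 - δ) * l :=
      mul_nonneg (mul_nonneg hx (by linarith)) (by linarith)
    refine le_trans ?_ e4
    rw [hz]
    nlinarith only [e1, e2, e5, hx, hp]
  calc 3 * (1 - p ^ 2) = (1 - p) * (3 * (1 + p)) := by ring
    _ ≤ (1 - p) * ((1 + δ) ^ 2 * (2 + 2 * z)) :=
        mul_le_mul_of_nonneg_left hpoly (by linarith)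
    _ = (1 + δ) ^ 2 * ((1 - p) * (2 + 2 * z)) := by ring
    _ ≤ _ := mul_le_mul_of_nonneg_left hsq (sq_nonneg _)

/-! ### The comparison of the two quadratic forms -/

/-- Multiplying by `c`, the coefficient of `R^2`, completes the square in `R`; the remaining
coefficient of `A^2` is `n^4 * τ * (1 - τ)` times the quantity assumed positive. -/
lemma quadForm_nonneg_of_discr {n w l τ A R : ℝ} (hτ : 0 < τ) (hτ1 : τ < 1) (hn : 0 < n)
    (h : 0 < n ^ 4 * w ^ 2 * l ^ 2 - 3 * τ * (1 - τ) - 3 * (n * w * l - (w - τ)) ^ 2) :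
    0 ≤ n ^ 4 * (τ * (1 - τ) * A ^ 2 + (w * (A + R * l) - τ * A) ^ 2)
      - 3 * τ * (1 - τ) * (n * A + R) ^ 2 := by
  set c := n ^ 4 * w ^ 2 * l ^ 2 - 3 * τ * (1 - τ) with hc
  have hcpos : 0 < c := by nlinarith [sq_nonneg (n * w * l - (w - τ))]
  refine nonneg_of_mul_nonneg_right ?_ hcpos
  have key : c * (n ^ 4 * (τ * (1 - τ) * A ^ 2 + (w * (A + R * l) - τ * A) ^ 2)
      - 3 * τ * (1 - τ) * (n * A + R) ^ 2) =
      (c * R + (n ^ 4 * (w - τ) * w * l - 3 * τ * (1 - τ) * n) * A) ^ 2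
      + n ^ 4 * (τ * (1 - τ)) * (c - 3 * (n * w * l - (w - τ)) ^ 2) * A ^ 2 := by
    rw [hc]; ring
  rw [key]
  have : 0 ≤ τ * (1 - τ) := mul_nonneg hτ.le (by linarith)
  have := mul_nonneg (mul_nonneg (mul_nonneg (pow_nonneg hn.le 4) this) h.le) (sq_nonneg A)
  nlinarith [sq_nonneg (c * R + (n ^ 4 * (w - τ) * w * l - 3 * τ * (1 - τ) * n) * A)]

lemma quadForm_nonneg_of_coeffs {n w l τ A R : ℝ} (hτ : 0 < τ) (hn : 1 ≤ n)
    (hl : 1 ≤ l) (hw : τ ≤ w) (hA : 0 ≤ A) (hR : 0 ≤ R)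
    (hG : 3 * τ * (1 - τ) ≤ n ^ 2 * (τ - 2 * τ * w + w ^ 2))
    (hM : 3 * τ * (1 - τ) ≤ n ^ 3 * l * (w ^ 2 - τ * w)) :
    0 ≤ n ^ 4 * (τ * (1 - τ) * A ^ 2 + (w * (A + R * l) - τ * A) ^ 2)
      - 3 * τ * (1 - τ) * (n * A + R) ^ 2 := by
  have hw0 : 0 < w := hτ.trans_le hw
  -- The coefficient of `R^2` dominates the cross coefficient, because `n * l ≥ 1`.
  have hC : 3 * τ * (1 - τ) ≤ n ^ 4 * w ^ 2 * l ^ 2 := by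
    refine hM.trans ?_
    have e1 : 1 ≤ n * l := one_le_mul_of_one_le_of_one_le hn hl
    calc n ^ 3 * l * (w ^ 2 - τ * w) ≤ n ^ 3 * l * w ^ 2 := by
          refine mul_le_mul_of_nonneg_left ?_ (by positivity)
          nlinarith [mul_pos hτ hw0]
      _ ≤ n ^ 3 * l * w ^ 2 * (n * l) := le_mul_of_one_le_right (by positivity) e1
      _ = _ := by ring
  have key : n ^ 4 * (τ * (1 - τ) * A ^ 2 + (w * (A + R * l) - τ * A) ^ 2)
      - 3 * τ * (1 - τ) * (n * A + R) ^ 2 =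
      n ^ 2 * A ^ 2 * (n ^ 2 * (τ - 2 * τ * w + w ^ 2) - 3 * τ * (1 - τ))
      + 2 * n * A * R * (n ^ 3 * l * (w ^ 2 - τ * w) - 3 * τ * (1 - τ))
      + R ^ 2 * (n ^ 4 * w ^ 2 * l ^ 2 - 3 * τ * (1 - τ)) := by ring
  rw [key]
  have := sub_nonneg.2 hC
  have := sub_nonneg.2 hM
  have := sub_nonneg.2 hG
  positivity

/-- Neither criterion covers all exponents: the cross coefficient is negative at `δ = 0.8`, `l =
1.505`, and the discriminant condition fails for `l = 4.4` as `δ → 0`. -/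
lemma quadForm_nonneg {l δ A : ℝ} (h1 : 1.505 ≤ l) (h2 : l ≤ 4.4229) (hδ : 0 < δ)
    (hδ' : δ ≤ 0.8) (hA : 0 ≤ A) :
    0 ≤ (1 + δ) ^ 4 * (Real.exp (-l) * (1 - Real.exp (-l)) * A ^ 2
        + (Real.exp (-(δ * l)) * (A + δ * l) - Real.exp (-l) * A) ^ 2)
      - 3 * Real.exp (-l) * (1 - Real.exp (-l)) * ((1 + δ) * A + δ) ^ 2 := by
  have hτ := Real.exp_pos (-l)
  have hτ1 : Real.exp (-l) < 1 := Real.exp_lt_one_iff.2 (by linarith)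
  rcases le_total δ 0.55 with hδ1 | hδ1
  · have hE : Real.exp (-l) * Real.exp ((1 - 2 * δ) * l) = Real.exp (-(δ * l)) ^ 2 := by
      rw [← Real.exp_nat_mul, ← Real.exp_add]; congr 1; push_cast; ring
    have hG : 3 * (1 - Real.exp (-l)) ≤
        (1 + δ) ^ 2 * (1 - 2 * Real.exp (-(δ * l)) + Real.exp ((1 - 2 * δ) * l)) := by
      rcases le_total δ 0.5 with h | h
      · exact square_coeff_nonneg_of_le_half h1 hδ h
      · exact square_coeff_nonneg_of_half_le h1 h2 h hδ1
    have hM := cross_coeff_nonneg h1 h2 hδ hδ1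
    refine quadForm_nonneg_of_coeffs hτ (by linarith) (by linarith)
      (Real.exp_le_exp.2 (by nlinarith)) hA hδ.le ?_ ?_
    · rw [← hE]
      linarith [mul_le_mul_of_nonneg_left hG hτ.le]
    · rw [← hE]
      linarith [mul_le_mul_of_nonneg_left hM hτ.le]
  · refine quadForm_nonneg_of_discr hτ hτ1 (by linarith) ?_
    have hF := mul_pos (infoDiscr_pos h1 h2 hδ1 hδ') (pow_pos (Real.exp_pos (-(δ * l))) 2)
    have e1 : Real.exp (-((1 - δ) * l)) * Real.exp (-(δ * l)) = Real.exp (-l) := by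
      rw [← Real.exp_add]; congr 1; ring
    have e2 : Real.exp ((2 * δ - 1) * l) * Real.exp (-(δ * l)) ^ 2 = Real.exp (-l) := by
      rw [← Real.exp_nat_mul, ← Real.exp_add]; congr 1; push_cast; ring
    refine hF.trans_eq ?_
    unfold infoDiscr
    linear_combination (-3) * e2
      - 6 * ((1 + δ) * l - 1) * Real.exp (-(δ * l)) * e1

/-- The information in the cost is at most that in the pair of prices, in normalised form:
`τ = t / T`, `A = 1 - δ log (v T)`. -/
theorem normalized_info_le {τ δ A : ℝ} (h1 : 0.012 ≤ τ) (h2 : τ ≤ 0.222) (hδ : 0 < δ)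
    (hδ' : δ ≤ 0.8) (hA : 0 ≤ A) :
    3 * (((1 + δ) * A + δ) / (1 + δ) ^ 2) ^ 2 ≤
      (τ ^ δ * (A - δ * Real.log τ)) ^ 2 / τ
        + (A - τ ^ δ * (A - δ * Real.log τ)) ^ 2 / (1 - τ) := by
  have hτ : 0 < τ := by linarith
  have hτ1 : 0 < 1 - τ := by linarith
  set l := -Real.log τ with hl
  have hτl : Real.exp (-l) = τ := by rw [hl, neg_neg, Real.exp_log hτ]
  have hwl : Real.exp (-(δ * l)) = τ ^ δ := by
    rw [Real.rpow_def_of_pos hτ, hl]; congr 1; ring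
  -- `1.505` and `4.4229` are `-log 0.222` and `-log 0.012`, rounded outwards.
  have hl1 : 1.505 ≤ l := by
    have c3 : 0.222 ≤ Real.exp (-1.505) :=
      le_exp_neg_of_taylor_pow 8 (by norm_num) (by norm_num) (by norm_num) (by norm_num)
        (by norm_num)
    have := (Real.exp_le_exp).1 ((hτl.le.trans h2).trans c3)
    linarith
  have hl2 : l ≤ 4.4229 := by
    have c3 : Real.exp (-4.4229) ≤ 0.012 :=
      exp_neg_le_of_taylor_pow 32 (by norm_num) (by norm_num) (by norm_num) (by norm_num)
    have := (Real.exp_le_exp).1 ((c3.trans h1).trans hτl.ge)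
    linarith
  have key := quadForm_nonneg hl1 hl2 hδ hδ' hA
  rw [hτl, hwl] at key
  have hlog : Real.log τ = -l := by rw [hl, neg_neg]
  -- With `B = w * (A + δ * l)`, the form in `key` arises from `(1 - τ)B² + τ(A - B)² = τ(1 - τ)A² +
  -- (B - τA)²`.
  rw [hlog, div_pow, div_add_div _ _ hτ.ne' hτ1.ne', ← mul_div_assoc,
    div_le_div_iff₀ (by positivity) (by positivity)]
  nlinarith only [key]

/-! ### The integral of a Brownian path -/

lemma tendsto_riemannSum {g : ℝ → ℝ} (hg : Continuous g) {T : ℝ} (hT : 0 < T) :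
    Filter.Tendsto (fun n : ℕ => ∑ k ∈ Finset.range (n + 1), T / (n + 1) * g (k * (T / (n + 1))))
      Filter.atTop (nhds (∫ x in (0 : ℝ)..T, g x)) := by
  rw [Metric.tendsto_atTop]
  intro ε hε
  have huc := isCompact_Icc.uniformContinuousOn_of_continuous (s := Set.Icc 0 T) hg.continuousOn
  obtain ⟨d, hd, hgd⟩ := Metric.uniformContinuousOn_iff.1 huc (ε / (2 * T)) (by positivity)
  obtain ⟨N, hN⟩ := exists_nat_gt (T / d)
  refine ⟨N, fun n hn => ?_⟩
  set h : ℝ := T / (n + 1) with hh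
  have hn1 : (0 : ℝ) < n + 1 := by positivity
  have hh0 : 0 < h := by positivity
  have hhT : (n + 1 : ℝ) * h = T := by rw [hh]; field_simp
  have hhd : h < d := by
    rw [hh, div_lt_iff₀ hn1]
    rw [div_lt_iff₀ hd] at hN
    have : (N : ℝ) ≤ n := by exact_mod_cast hn
    nlinarith
  have hsum : ∫ x in (0 : ℝ)..T, g x =
      ∑ k ∈ Finset.range (n + 1), ∫ x in (k * h)..((k + 1 : ℕ) * h), g x := by
    rw [intervalIntegral.sum_integral_adjacent_intervals (a := fun k : ℕ => (k : ℝ) * h)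
      fun k _ => hg.intervalIntegrable _ _]
    simp [hhT]
  have hterm : ∀ k ∈ Finset.range (n + 1),
      ‖h * g (k * h) - ∫ x in (k * h)..((k + 1 : ℕ) * h), g x‖ ≤ ε / (2 * T) * h := by
    intro k hk
    have hk1 : (k : ℝ) + 1 ≤ n + 1 := by
      have := Finset.mem_range.1 hk
      exact_mod_cast this
    have hle : (k : ℝ) * h ≤ (k + 1 : ℕ) * h := by push_cast; nlinarith
    have hconst : h * g (k * h) = ∫ _ in (k * h)..((k + 1 : ℕ) * h), g (k * h) := by
      rw [intervalIntegral.integral_const, smul_eq_mul]; push_cast; ring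
    rw [hconst, ← intervalIntegral.integral_sub (by simp) (hg.intervalIntegrable _ _)]
    have := intervalIntegral.norm_integral_le_of_norm_le_const (a := k * h)
      (b := (k + 1 : ℕ) * h) (f := fun x => g (k * h) - g x) (C := ε / (2 * T)) ?_
    · refine this.trans (le_of_eq ?_)
      rw [abs_of_nonneg (by linarith)]; push_cast; ring
    · intro x hx
      rw [Set.uIoc_of_le hle] at hx
      push_cast at hx
      have hk0 : 0 ≤ (k : ℝ) * h := by positivity
      have hkT : ((k : ℝ) + 1) * h ≤ T := by
        rw [← hhT]; exact mul_le_mul_of_nonneg_right hk1 hh0.le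
      have := hgd (k * h) ⟨hk0, by nlinarith⟩ x ⟨by linarith [hx.1], by linarith [hx.2]⟩
        (by rw [Real.dist_eq, abs_lt]; constructor <;> nlinarith [hx.1, hx.2])
      rw [Real.dist_eq] at this
      exact this.le
  rw [dist_eq_norm, hsum, ← Finset.sum_sub_distrib]
  refine lt_of_le_of_lt (norm_sum_le_of_le _ hterm) ?_
  rw [Finset.sum_const, Finset.card_range, nsmul_eq_mul]
  push_cast
  calc ((n : ℝ) + 1) * (ε / (2 * T) * h) = ε / (2 * T) * ((n + 1) * h) := by ring
    _ = ε / 2 := by rw [hhT]; field_simp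
    _ < ε := by linarith

/-- Characteristic functions converge by dominated convergence, and the Gaussian one is continuous
in the variance. Unlike densities, they allow the variance to vanish. -/
lemma hasLaw_gaussianReal_of_ae_tendsto {Ω : Type*} [MeasurableSpace Ω] {P : Measure Ω}
    {X : ℕ → Ω → ℝ} {Y : Ω → ℝ} {V : ℕ → ℝ≥0} {V' : ℝ≥0}
    (hX : ∀ n, HasLaw (X n) (gaussianReal 0 (V n)) P)
    (hlim : ∀ᵐ ω ∂P, Filter.Tendsto (fun n => X n ω) Filter.atTop (nhds (Y ω)))
    (hV : Filter.Tendsto V Filter.atTop (nhds V')) :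
    HasLaw Y (gaussianReal 0 V') P := by
  have hP : IsProbabilityMeasure P := (hX 0).isProbabilityMeasure
  have hY : AEMeasurable Y P :=
    aemeasurable_of_tendsto_metrizable_ae Filter.atTop (fun n => (hX n).aemeasurable) hlim
  refine ⟨hY, ?_⟩
  have : IsProbabilityMeasure (P.map Y) := Measure.isProbabilityMeasure_map hY
  refine Measure.ext_of_charFun (funext fun ξ => ?_)
  have hchar {Z : Ω → ℝ} (hZ : AEMeasurable Z P) :
      charFun (P.map Z) ξ = ∫ ω, Complex.exp (ξ * Z ω * Complex.I) ∂P := by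
    rw [charFun_apply_real, integral_map hZ (by fun_prop)]
  have h1 : Filter.Tendsto (fun n => ∫ ω, Complex.exp (ξ * X n ω * Complex.I) ∂P) Filter.atTop
      (nhds (∫ ω, Complex.exp (ξ * Y ω * Complex.I) ∂P)) := by
    refine tendsto_integral_of_dominated_convergence (fun _ => 1) (fun n => ?_)
      (integrable_const 1) (fun n => ?_) ?_
    · have := (hX n).aemeasurable
      exact (by fun_prop : AEMeasurable
        (fun ω => Complex.exp (ξ * X n ω * Complex.I)) P).aestronglyMeasurable
    · refine Filter.Eventually.of_forall fun ω => ?_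
      rw [← Complex.ofReal_mul, Complex.norm_exp_ofReal_mul_I]
    · filter_upwards [hlim] with ω hω
      have hc : Continuous fun y : ℝ => Complex.exp (ξ * y * Complex.I) := by fun_prop
      exact (hc.tendsto _).comp hω
  have h2 : Filter.Tendsto (fun n => charFun (gaussianReal 0 (V n)) ξ) Filter.atTop
      (nhds (charFun (gaussianReal 0 V') ξ)) := by
    simp only [charFun_gaussianReal]
    have hc : Continuous fun y : ℝ≥0 =>
        Complex.exp (ξ * (0 : ℝ) * Complex.I - ((y : ℝ) : ℂ) * ξ ^ 2 / 2) := by fun_prop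
    exact (hc.tendsto _).comp hV
  rw [hchar hY]
  refine tendsto_nhds_unique h1 (h2.congr fun n => ?_)
  rw [← hchar (hX n).aemeasurable, (hX n).map_eq]

lemma sum_sum_min (n : ℕ) :
    ∑ j ∈ Finset.range n, ∑ k ∈ Finset.range n, min (j : ℝ) k = (n - 1) * n * (2 * n - 1) / 6 := by
  induction n with
  | zero => simp
  | succ n ih =>
    have hG : ∑ k ∈ Finset.range n, (k : ℝ) = n * (n - 1) / 2 := by
      clear ih
      induction n with
      | zero => simp
      | succ m ihm => rw [Finset.sum_range_succ, ihm]; push_cast; ring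
    have h1 : ∑ k ∈ Finset.range n, min (n : ℝ) k = n * (n - 1) / 2 := by
      rw [← hG]
      refine Finset.sum_congr rfl fun k hk => min_eq_right ?_
      exact_mod_cast (Finset.mem_range.1 hk).le
    have h2 : ∑ k ∈ Finset.range n, min (k : ℝ) n = n * (n - 1) / 2 := by
      simpa only [min_comm] using h1
    simp_rw [Finset.sum_range_succ, Finset.sum_add_distrib]
    rw [ih, h1, h2]
    simp
    ring

/-- Left Riemann sums of mesh `h = T / (n + 1)` are Gaussian with variance `h^3 ∑ min(j, k)`, which
tends to `∬ min(s, t) = T^3 / 3`. -/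
theorem ProbabilityTheory.IsBrownianReal.hasLaw_integral {Ω : Type*} [MeasurableSpace Ω] {P : Measure Ω}
    {W : ℝ≥0 → Ω → ℝ} (hW : IsBrownianReal W P) {T : ℝ} (hT : 0 < T) :
    HasLaw (fun ω => ∫ s in (0 : ℝ)..T, W s.toNNReal ω)
      (gaussianReal 0 (T ^ 3 / 3).toNNReal) P := by
  have hP : IsProbabilityMeasure P := hW.isGaussianProcess.isProbabilityMeasure
  let f (n k : ℕ) : ℝ≥0 := (k * (T / (n + 1))).toNNReal
  let X (n : ℕ) (ω : Ω) : ℝ := ∑ k ∈ Finset.range (n + 1), T / (n + 1) * W (f n k) ω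
  let V (n : ℕ) : ℝ := (T / (n + 1)) ^ 3 * (n * (n + 1) * (2 * n + 1) / 6)
  have hL2 (t : ℝ≥0) : MemLp (W t) 2 P := (hW.isGaussianProcess.hasGaussianLaw_eval t).memLp_two
  have hX (n : ℕ) : HasLaw (X n) (gaussianReal 0 (V n).toNNReal) P := by
    have hg : HasGaussianLaw (X n) P :=
      ((hW.isGaussianProcess.comp_right (f n)).smul
        (fun _ => T / (n + 1))).hasGaussianLaw_fun_sum (I := Finset.range (n + 1))
    have hmean : P[X n] = 0 := by
      simp only [X]
      rw [integral_finsetSum _ fun k _ => (hW.integrable_eval _).const_mul _]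
      simp_rw [integral_const_mul, hW.integral_eval]
      simp
    have hvar : Var[X n; P] = V n := by
      simp only [X]
      rw [variance_fun_sum' fun k _ => (hL2 (f n k)).const_mul _]
      simp_rw [covariance_const_mul_left, covariance_const_mul_right]
      have hcov (j k : ℕ) : cov[W (f n j), W (f n k); P] = T / (n + 1) * min (j : ℝ) k := by
        rw [hW.covariance_eval]
        have hh : 0 ≤ T / ((n : ℝ) + 1) := by positivity
        rw [NNReal.coe_min, Real.coe_toNNReal _ (by positivity),
          Real.coe_toNNReal _ (by positivity), mul_comm, mul_comm (k : ℝ), mul_min_of_nonneg _ _ hh]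
      have hcov' (j k : ℕ) : cov[fun ω => W (f n j) ω, fun ω => W (f n k) ω; P]
          = T / (n + 1) * min (j : ℝ) k := hcov j k
      simp_rw [hcov', ← Finset.mul_sum, sum_sum_min]
      push_cast
      ring
    exact ⟨hg.aemeasurable, by rw [hg.map_eq_gaussianReal, hmean, hvar]⟩
  refine hasLaw_gaussianReal_of_ae_tendsto hX ?_ ?_
  · filter_upwards [hW.cont] with ω hω
    exact tendsto_riemannSum (g := fun s => W s.toNNReal ω)
      (hω.comp continuous_real_toNNReal) hT
  · refine (continuous_real_toNNReal.tendsto _).comp ?_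
    have h0 : Filter.Tendsto (fun n : ℕ => 1 / ((n : ℝ) + 1)) Filter.atTop (nhds 0) :=
      tendsto_one_div_add_atTop_nhds_zero_nat
    have h1 : Filter.Tendsto (fun n : ℕ => T ^ 3 * ((1 - 1 / ((n : ℝ) + 1)) *
        (2 - 1 / ((n : ℝ) + 1)) / 6)) Filter.atTop (nhds (T ^ 3 * ((1 - 0) * (2 - 0) / 6))) :=
      ((((tendsto_const_nhds.sub h0).mul (tendsto_const_nhds.sub h0)).div_const 6).const_mul _)
    have h2 : T ^ 3 * ((1 - 0) * (2 - 0) / 6) = T ^ 3 / 3 := by ring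
    rw [h2] at h1
    refine h1.congr fun n => ?_
    simp only [V]
    have : (n : ℝ) + 1 ≠ 0 := by positivity
    field_simp
    ring

/-! ### Fisher information from one likelihood -/

/-- At each rational parameter the densities agree off a null set. Countably many null sets are
discarded, and continuity in the parameter extends the equality to the open set `Θ`. -/
lemma IsLikelihood.ae_eqOn {E : Type*} [MeasureSpace E] [SigmaFinite (volume : Measure E)]
    {Θ : Set ℝ} (hΘ : IsOpen Θ) {Q : ℝ → Measure E} {p q : ℝ → E → ℝ}
    (hp : IsLikelihood Θ Q p) (hq : IsLikelihood Θ Q q) :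
    ∀ᵐ x, Set.EqOn (fun θ => p θ x) (fun θ => q θ x) Θ := by
  have h : ∀ᵐ x, ∀ r : ℚ, (r : ℝ) ∈ Θ → p r x = q r x := by
    refine ae_all_iff.2 fun r => ?_
    by_cases hr : (r : ℝ) ∈ Θ
    · have hae := (withDensity_eq_iff_of_sigmaFinite
        (hp.measurable r hr).ennreal_ofReal.aemeasurable
        (hq.measurable r hr).ennreal_ofReal.aemeasurable).1
        ((hp.law_eq r hr).symm.trans (hq.law_eq r hr))
      filter_upwards [hae] with x hx _
      exact (ENNReal.ofReal_eq_ofReal_iff (hp.pos r hr x).le (hq.pos r hr x).le).1 hx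
    · exact Filter.Eventually.of_forall fun x h => absurd h hr
  filter_upwards [h] with x hx
  refine Set.EqOn.of_subset_closure (s := Θ ∩ Set.range ((↑) : ℚ → ℝ)) ?_
    (hp.differentiable x).continuousOn (hq.differentiable x).continuousOn Set.inter_subset_left
    (Rat.denseRange_cast.open_subset_closure_inter hΘ)
  rintro _ ⟨hr, r, rfl⟩
  exact hx r hr

lemma IsLikelihood.hasFisherInfo {E : Type*} [MeasureSpace E] [SigmaFinite (volume : Measure E)]
    {Θ : Set ℝ} (hΘ : IsOpen Θ) {Q : ℝ → Measure E} {p : ℝ → E → ℝ} (hp : IsLikelihood Θ Q p)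
    {θ I : ℝ} (hθ : θ ∈ Θ) {score : E → ℝ}
    (hscore : ∀ x, HasDerivAt (fun η => Real.log (p η x)) (score x) θ)
    (hint : Integrable (fun x => score x ^ 2) (Q θ)) (hI : ∫ x, score x ^ 2 ∂(Q θ) = I) :
    HasFisherInfo Θ Q θ I := by
  refine ⟨⟨p, hp⟩, fun q hq => ?_⟩
  have hae : (fun x => score x ^ 2) =ᵐ[Q θ]
      fun x => (deriv (fun η => Real.log (q η x)) θ) ^ 2 := by
    rw [hp.law_eq θ hθ]
    refine (withDensity_absolutelyContinuous _ _).ae_eq ?_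
    filter_upwards [hp.ae_eqOn hΘ hq] with x hx
    have : (fun η => Real.log (q η x)) =ᶠ[nhds θ] fun η => Real.log (p η x) := by
      filter_upwards [hΘ.mem_nhds hθ] with η hη
      exact congrArg Real.log (hx hη).symm
    rw [this.deriv_eq, (hscore x).deriv]
  exact ⟨hint.congr hae, by rw [← integral_congr_ae hae, hI]⟩

/-! ### Gaussian location families -/

lemma hasDerivAt_gaussianPDFReal {m : ℝ → ℝ} {m' θ x : ℝ} {V : ℝ≥0} (hm : HasDerivAt m m' θ) :
    HasDerivAt (fun η => gaussianPDFReal (m η) V x)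
      (gaussianPDFReal (m θ) V x * (m' * (x - m θ) / V)) θ := by
  have h := (((((hm.const_sub x).pow 2).neg).div_const (2 * (V : ℝ))).exp).const_mul
    ((Real.sqrt (2 * Real.pi * V))⁻¹)
  refine h.congr_deriv ?_
  simp only [gaussianPDFReal, Pi.neg_apply, Pi.pow_apply]
  push_cast
  by_cases hV : (V : ℝ) = 0
  · simp [hV]
  · field_simp

lemma hasDerivAt_log_gaussianPDFReal {m : ℝ → ℝ} {m' θ x : ℝ} {V : ℝ≥0} (hV : V ≠ 0)
    (hm : HasDerivAt m m' θ) :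
    HasDerivAt (fun η => Real.log (gaussianPDFReal (m η) V x)) (m' * (x - m θ) / V) θ := by
  have hpos := (gaussianPDFReal_pos (m θ) V x hV).ne'
  refine ((hasDerivAt_gaussianPDFReal hm).log hpos).congr_deriv ?_
  rw [mul_div_cancel_left₀ _ hpos]

lemma integrable_sub_gaussianReal (μ : ℝ) (V : ℝ≥0) :
    Integrable (fun x => x - μ) (gaussianReal μ V) :=
  ((memLp_id_gaussianReal 1).integrable (by simp)).sub (integrable_const μ)

lemma integrable_sub_sq_gaussianReal (μ : ℝ) (V : ℝ≥0) :
    Integrable (fun x => (x - μ) ^ 2) (gaussianReal μ V) :=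
  MemLp.integrable_sq ((memLp_id_gaussianReal 2).sub (memLp_const μ))

lemma integral_sub_gaussianReal (μ : ℝ) (V : ℝ≥0) :
    ∫ x, (x - μ) ∂(gaussianReal μ V) = 0 := by
  have h : Integrable (fun x : ℝ => x) (gaussianReal μ V) :=
    (memLp_id_gaussianReal 1).integrable (by simp)
  rw [integral_sub h (integrable_const μ)]
  simp [integral_id_gaussianReal]

lemma integral_sub_sq_gaussianReal (μ : ℝ) (V : ℝ≥0) :
    ∫ x, (x - μ) ^ 2 ∂(gaussianReal μ V) = V := by
  have := variance_fun_id_gaussianReal (μ := μ) (v := V)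
  rw [variance_eq_integral (by fun_prop), integral_id_gaussianReal] at this
  exact this

lemma isLikelihood_gaussianReal {Θ : Set ℝ} {Q : ℝ → Measure ℝ} {m : ℝ → ℝ} {V : ℝ≥0}
    (hV : V ≠ 0) (hQ : ∀ θ ∈ Θ, Q θ = gaussianReal (m θ) V)
    (hm : ∀ θ ∈ Θ, DifferentiableAt ℝ m θ) :
    IsLikelihood Θ Q fun θ x => gaussianPDFReal (m θ) V x where
  measurable θ _ := measurable_gaussianPDFReal _ _
  pos θ _ x := gaussianPDFReal_pos _ _ x hV
  law_eq θ hθ := by rw [hQ θ hθ, gaussianReal_of_var_ne_zero _ hV]; rfl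
  differentiable x θ hθ :=
    (hasDerivAt_gaussianPDFReal (hm θ hθ).hasDerivAt).differentiableAt.differentiableWithinAt

/-- The Fisher information of a Gaussian location family with constant variance. -/
theorem hasFisherInfo_gaussianReal {Θ : Set ℝ} (hΘ : IsOpen Θ) {Q : ℝ → Measure ℝ} {m : ℝ → ℝ}
    {V : ℝ≥0} (hV : V ≠ 0) (hQ : ∀ θ ∈ Θ, Q θ = gaussianReal (m θ) V)
    (hm : ∀ θ ∈ Θ, DifferentiableAt ℝ m θ) {θ m' : ℝ} (hθ : θ ∈ Θ) (hm' : HasDerivAt m m' θ) :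
    HasFisherInfo Θ Q θ (m' ^ 2 / V) := by
  have heq : (fun x => (m' * (x - m θ) / V) ^ 2) = fun x => (m' / V) ^ 2 * (x - m θ) ^ 2 := by
    ext x; ring
  refine (isLikelihood_gaussianReal hV hQ hm).hasFisherInfo hΘ hθ
    (fun x => hasDerivAt_log_gaussianPDFReal hV hm') ?_ ?_
  · rw [hQ θ hθ, heq]
    exact (integrable_sub_sq_gaussianReal _ _).const_mul _
  · rw [hQ θ hθ, heq, integral_const_mul, integral_sub_sq_gaussianReal]
    have : (V : ℝ) ≠ 0 := by exact_mod_cast hV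
    field_simp

lemma map_withDensity_comp {α : Type*} [MeasurableSpace α] {μ : Measure α} {e : α → α}
    (he : MeasurePreserving e μ μ) {f : α → ENNReal} (hf : Measurable f) :
    (μ.withDensity (f ∘ e)).map e = μ.withDensity f := by
  ext s hs
  rw [Measure.map_apply he.measurable hs, withDensity_apply _ (he.measurable hs),
    withDensity_apply _ hs]
  exact he.setLIntegral_comp_preimage hs hf

/-- The law of `(U, U + D)` for independent Gaussian variables `U` and `D`. -/
noncomputable def gaussianCumulLaw (μ ν : ℝ) (V₁ V₂ : ℝ≥0) : Measure (ℝ × ℝ) :=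
  ((gaussianReal μ V₁).prod (gaussianReal ν V₂)).map fun z => (z.1, z.1 + z.2)

/-- The shear `(x, y) ↦ (x, x + y)` preserves Lebesgue measure, so no Jacobian appears. -/
lemma gaussianCumulLaw_eq_withDensity (μ ν : ℝ) {V₁ V₂ : ℝ≥0} (h₁ : V₁ ≠ 0) (h₂ : V₂ ≠ 0) :
    gaussianCumulLaw μ ν V₁ V₂ = (volume : Measure (ℝ × ℝ)).withDensity fun z =>
      ENNReal.ofReal (gaussianPDFReal μ V₁ z.1 * gaussianPDFReal ν V₂ (z.2 - z.1)) := by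
  have hm : Measurable fun z : ℝ × ℝ =>
      ENNReal.ofReal (gaussianPDFReal μ V₁ z.1 * gaussianPDFReal ν V₂ (z.2 - z.1)) :=
    (((measurable_gaussianPDFReal _ _).comp measurable_fst).mul
      ((measurable_gaussianPDFReal _ _).comp (measurable_snd.sub measurable_fst))).ennreal_ofReal
  rw [gaussianCumulLaw, gaussianReal_of_var_ne_zero _ h₁, gaussianReal_of_var_ne_zero _ h₂,
    prod_withDensity (measurable_gaussianPDF _ _) (measurable_gaussianPDF _ _),
    Measure.volume_eq_prod,
    ← map_withDensity_comp (measurePreserving_prod_add (volume : Measure ℝ) volume) hm]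
  congr 2
  ext z
  simp only [Function.comp, gaussianPDF, add_sub_cancel_left]
  rw [ENNReal.ofReal_mul (gaussianPDFReal_nonneg _ _ _)]

lemma integrable_and_integral_sq_gaussian_prod (μ ν α β : ℝ) (V₁ V₂ : ℝ≥0) :
    Integrable (fun z : ℝ × ℝ => (α * (z.1 - μ) + β * (z.2 - ν)) ^ 2)
        ((gaussianReal μ V₁).prod (gaussianReal ν V₂)) ∧
      ∫ z, (α * (z.1 - μ) + β * (z.2 - ν)) ^ 2 ∂((gaussianReal μ V₁).prod (gaussianReal ν V₂))
        = α ^ 2 * V₁ + β ^ 2 * V₂ := by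
  have heq : (fun z : ℝ × ℝ => (α * (z.1 - μ) + β * (z.2 - ν)) ^ 2) = fun z =>
      (α ^ 2 * (z.1 - μ) ^ 2 + 2 * α * β * ((z.1 - μ) * (z.2 - ν))) + β ^ 2 * (z.2 - ν) ^ 2 := by
    ext z; ring
  have i1 : Integrable (fun z : ℝ × ℝ => α ^ 2 * (z.1 - μ) ^ 2)
      ((gaussianReal μ V₁).prod (gaussianReal ν V₂)) :=
    ((integrable_sub_sq_gaussianReal μ V₁).comp_fst _).const_mul _
  have i2 : Integrable (fun z : ℝ × ℝ => 2 * α * β * ((z.1 - μ) * (z.2 - ν)))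
      ((gaussianReal μ V₁).prod (gaussianReal ν V₂)) :=
    ((integrable_sub_gaussianReal μ V₁).mul_prod (integrable_sub_gaussianReal ν V₂)).const_mul _
  have i3 : Integrable (fun z : ℝ × ℝ => β ^ 2 * (z.2 - ν) ^ 2)
      ((gaussianReal μ V₁).prod (gaussianReal ν V₂)) :=
    ((integrable_sub_sq_gaussianReal ν V₂).comp_snd _).const_mul _
  rw [heq]
  refine ⟨(i1.add i2).add i3, ?_⟩
  rw [integral_add (by exact i1.add i2) i3, integral_add i1 i2, integral_const_mul, integral_const_mul,
    integral_const_mul, integral_prod_mul (fun x => x - μ) (fun y => y - ν),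
    integral_fun_fst (fun x => (x - μ) ^ 2), integral_fun_snd (fun x => (x - ν) ^ 2),
    integral_sub_sq_gaussianReal, integral_sub_sq_gaussianReal, integral_sub_gaussianReal]
  simp

/-- The Fisher information of the pair of partial sums of two independent Gaussian location
families with constant variances. -/
theorem hasFisherInfo_gaussianCumulLaw {Θ : Set ℝ} (hΘ : IsOpen Θ) {Q : ℝ → Measure (ℝ × ℝ)}
    {m d : ℝ → ℝ} {V₁ V₂ : ℝ≥0} (h₁ : V₁ ≠ 0) (h₂ : V₂ ≠ 0)
    (hQ : ∀ θ ∈ Θ, Q θ = gaussianCumulLaw (m θ) (d θ) V₁ V₂)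
    (hm : ∀ θ ∈ Θ, DifferentiableAt ℝ m θ) (hd : ∀ θ ∈ Θ, DifferentiableAt ℝ d θ)
    {θ m' d' : ℝ} (hθ : θ ∈ Θ) (hm' : HasDerivAt m m' θ) (hd' : HasDerivAt d d' θ) :
    HasFisherInfo Θ Q θ (m' ^ 2 / V₁ + d' ^ 2 / V₂) := by
  have hlik : IsLikelihood Θ Q fun θ z =>
      gaussianPDFReal (m θ) V₁ z.1 * gaussianPDFReal (d θ) V₂ (z.2 - z.1) :=
    { measurable := fun θ _ => ((measurable_gaussianPDFReal _ _).comp measurable_fst).mul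
        ((measurable_gaussianPDFReal _ _).comp (measurable_snd.sub measurable_fst))
      pos := fun θ _ z => mul_pos (gaussianPDFReal_pos _ _ _ h₁) (gaussianPDFReal_pos _ _ _ h₂)
      law_eq := fun θ hθ => by rw [hQ θ hθ, gaussianCumulLaw_eq_withDensity _ _ h₁ h₂]
      differentiable := fun z θ hθ =>
        ((hasDerivAt_gaussianPDFReal (hm θ hθ).hasDerivAt).mul
          (hasDerivAt_gaussianPDFReal
            (hd θ hθ).hasDerivAt)).differentiableAt.differentiableWithinAt }
  have hscore (z : ℝ × ℝ) : HasDerivAt (fun η => Real.log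
      (gaussianPDFReal (m η) V₁ z.1 * gaussianPDFReal (d η) V₂ (z.2 - z.1)))
      (m' * (z.1 - m θ) / V₁ + d' * (z.2 - z.1 - d θ) / V₂) θ := by
    refine ((hasDerivAt_log_gaussianPDFReal h₁ hm').add
      (hasDerivAt_log_gaussianPDFReal h₂ hd')).congr_of_eventuallyEq
      (Filter.Eventually.of_forall fun η => ?_)
    exact Real.log_mul (gaussianPDFReal_pos _ _ _ h₁).ne' (gaussianPDFReal_pos _ _ _ h₂).ne'
  have hshear : Measurable fun z : ℝ × ℝ => (z.1, z.1 + z.2) := by fun_prop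
  have hV₁ : (V₁ : ℝ) ≠ 0 := by exact_mod_cast h₁
  have hV₂ : (V₂ : ℝ) ≠ 0 := by exact_mod_cast h₂
  -- Undoing the shear makes the score linear in two independent centred variables, so the cross
  -- term integrates to zero.
  have hcomp : (fun z : ℝ × ℝ =>
      (m' * (z.1 - m θ) / V₁ + d' * (z.1 + z.2 - z.1 - d θ) / V₂) ^ 2) =
      fun z => (m' / V₁ * (z.1 - m θ) + d' / V₂ * (z.2 - d θ)) ^ 2 := by
    ext z; ring
  have hmeas : Measurable fun z : ℝ × ℝ =>
      (m' * (z.1 - m θ) / V₁ + d' * (z.2 - z.1 - d θ) / V₂) ^ 2 := by fun_prop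
  obtain ⟨hint, hval⟩ :=
    integrable_and_integral_sq_gaussian_prod (m θ) (d θ) (m' / V₁) (d' / V₂) V₁ V₂
  refine hlik.hasFisherInfo hΘ hθ hscore ?_ ?_
  · rw [hQ θ hθ, gaussianCumulLaw,
      integrable_map_measure hmeas.aestronglyMeasurable hshear.aemeasurable]
    simpa only [Function.comp_def, hcomp] using hint
  · rw [hQ θ hθ, gaussianCumulLaw, integral_map hshear.aemeasurable hmeas.aestronglyMeasurable,
      hcomp, hval]
    field_simp

/-! ### The laws of the price pair and of the cost -/

lemma integral_powerLaw_decay (a b v : ℝ) {δ t : ℝ} (hδ : 0 < δ) (hv : 0 < v) (ht : 0 ≤ t) :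
    ∫ s in (0 : ℝ)..t, a * v ^ δ * (b * (t - s) ^ (δ - 1)) = a * b * ((v * t) ^ δ / δ) := by
  rw [intervalIntegral.integral_const_mul, intervalIntegral.integral_const_mul,
    intervalIntegral.integral_comp_sub_left (fun s => s ^ (δ - 1)), sub_self, sub_zero,
    integral_rpow (Or.inl (by linarith)), sub_add_cancel, Real.zero_rpow hδ.ne', sub_zero,
    Real.mul_rpow hv.le ht]
  ring

lemma powerLawPrice_eq {Ω : Type*} (a b S₀ σ : ℝ) (W : ℝ≥0 → Ω → ℝ) {v δ t : ℝ} (hδ : 0 < δ)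
    (hv : 0 < v) (ht : 0 ≤ t) (ω : Ω) :
    powerLawPrice a b v S₀ σ W δ t ω
      = S₀ + a * b * ((v * t) ^ δ / δ) + σ * W t.toNNReal ω := by
  rw [powerLawPrice, propagatorPrice, integral_powerLaw_decay a b v hδ hv ht]

lemma pricePairLaw_eq {Ω : Type*} [MeasurableSpace Ω] {P : Measure Ω} {W : ℝ≥0 → Ω → ℝ}
    (hW : IsBrownianReal W P) (a b S₀ σ : ℝ) {v T t δ : ℝ} (hδ : 0 < δ) (hv : 0 < v)
    (ht : 0 ≤ t) (htT : t ≤ T) :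
    pricePairLaw P a b v T S₀ σ W t δ = gaussianCumulLaw (S₀ + a * b * ((v * t) ^ δ / δ))
      (a * b * ((v * T) ^ δ / δ - (v * t) ^ δ / δ))
      (σ ^ 2 * t).toNNReal (σ ^ 2 * (T - t)).toNNReal := by
  have hP : IsProbabilityMeasure P := hW.isGaussianProcess.isProbabilityMeasure
  have hσ := sq_nonneg σ
  have htT' : t.toNNReal ≤ T.toNNReal := Real.toNNReal_le_toNNReal htT
  set m := S₀ + a * b * ((v * t) ^ δ / δ)
  set d := a * b * ((v * T) ^ δ / δ - (v * t) ^ δ / δ) with hd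
  have hU : HasLaw (fun ω => m + σ * W t.toNNReal ω)
      (gaussianReal m (σ ^ 2 * t).toNNReal) P := by
    have h := gaussianReal_const_add (gaussianReal_const_mul (hW.hasLaw_eval t.toNNReal) σ) m
    convert h using 2
    · ring
    · refine NNReal.eq ?_
      rw [Real.coe_toNNReal _ (mul_nonneg hσ ht)]
      simp [ht]
  have hD : HasLaw (fun ω => d + σ * (W T.toNNReal - W t.toNNReal) ω)
      (gaussianReal d (σ ^ 2 * (T - t)).toNNReal) P := by
    have h := gaussianReal_const_add
      (gaussianReal_const_mul (hW.hasLaw_sub T.toNNReal t.toNNReal) σ) d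
    convert h using 2
    · ring
    · refine NNReal.eq ?_
      have hTt : 0 ≤ T - t := sub_nonneg.2 htT
      rw [Real.coe_toNNReal _ (mul_nonneg hσ hTt)]
      simp [Real.dist_eq, ht, ht.trans htT, abs_of_nonneg hTt]
  -- The deterministic impact only shifts the increments, so independence passes from `W` to `S_t`
  -- and `S_T - S_t`.
  have hind : IndepFun (fun ω => m + σ * W t.toNNReal ω)
      (fun ω => d + σ * (W T.toNNReal - W t.toNNReal) ω) P :=
    (hW.hasIndepIncrements.indepFun_eval_sub zero_le htT' hW.eval_zero_ae_eq_zero).comp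
      (φ := fun x => m + σ * x) (ψ := fun x => d + σ * x) (by fun_prop) (by fun_prop)
  have hprod := (indepFun_iff_map_prod_eq_prod_map_map hU.aemeasurable hD.aemeasurable).1 hind
  rw [hU.map_eq, hD.map_eq] at hprod
  rw [gaussianCumulLaw, ← hprod, AEMeasurable.map_map_of_aemeasurable (by fun_prop)
    (hU.aemeasurable.prodMk hD.aemeasurable), pricePairLaw]
  congr 1
  ext ω
  · simp only [Function.comp]
    rw [powerLawPrice_eq a b S₀ σ W hδ hv ht]
  · simp only [Function.comp, Pi.sub_apply]
    rw [powerLawPrice_eq a b S₀ σ W hδ hv (ht.trans htT), hd]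
    ring

lemma vwapCost_powerLawPrice {Ω : Type*} (a b S₀ σ : ℝ) {W : ℝ≥0 → Ω → ℝ} {v T δ : ℝ}
    (hδ : 0 < δ) (hv : 0 < v) (hT : 0 < T) {ω : Ω} (hω : Continuous fun t => W t ω) :
    vwapCost v T S₀ (powerLawPrice a b v S₀ σ W δ) ω =
      a * b * (v * T * (v * T) ^ δ / (δ * (δ + 1)))
        + v * σ * ∫ s in (0 : ℝ)..T, W s.toNNReal ω := by
  have hcong : ∫ t in (0 : ℝ)..T, powerLawPrice a b v S₀ σ W δ t ω =
      ∫ t in (0 : ℝ)..T, (S₀ + a * b * v ^ δ / δ * t ^ δ + σ * W t.toNNReal ω) := by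
    refine intervalIntegral.integral_congr fun t ht => ?_
    rw [Set.uIcc_of_le hT.le] at ht
    rw [powerLawPrice_eq a b S₀ σ W hδ hv ht.1, Real.mul_rpow hv.le ht.1]
    ring
  have hWc : Continuous fun t : ℝ => W t.toNNReal ω := hω.comp continuous_real_toNNReal
  have hr : Continuous fun t : ℝ => t ^ δ := Real.continuous_rpow_const hδ.le
  rw [vwapCost, hcong, intervalIntegral.integral_add, intervalIntegral.integral_add,
    intervalIntegral.integral_const_mul, intervalIntegral.integral_const_mul,
    intervalIntegral.integral_const, integral_rpow (Or.inl (by linarith)),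
    Real.zero_rpow (by linarith), Real.rpow_add_one hT.ne', Real.mul_rpow hv.le hT.le, smul_eq_mul]
  · have : δ + 1 ≠ 0 := by linarith
    field_simp
    ring
  all_goals exact Continuous.intervalIntegrable (by fun_prop) _ _

lemma vwapCostLaw_eq {Ω : Type*} [MeasurableSpace Ω] {P : Measure Ω} {W : ℝ≥0 → Ω → ℝ}
    (hW : IsBrownianReal W P) (a b S₀ σ : ℝ) {v T δ : ℝ} (hδ : 0 < δ) (hv : 0 < v)
    (hT : 0 < T) :
    vwapCostLaw P a b v T S₀ σ W δ = gaussianReal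
      (a * b * (v * T * (v * T) ^ δ / (δ * (δ + 1)))) ((v * σ) ^ 2 * (T ^ 3 / 3)).toNNReal := by
  have h := gaussianReal_const_add (gaussianReal_const_mul (hW.hasLaw_integral hT) (v * σ))
    (a * b * (v * T * (v * T) ^ δ / (δ * (δ + 1))))
  have hae : vwapCost v T S₀ (powerLawPrice a b v S₀ σ W δ) =ᵐ[P] fun ω =>
      a * b * (v * T * (v * T) ^ δ / (δ * (δ + 1)))
        + v * σ * ∫ s in (0 : ℝ)..T, W s.toNNReal ω := by
    filter_upwards [hW.cont] with ω hω
    exact vwapCost_powerLawPrice a b S₀ σ hδ hv hT hω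
  rw [vwapCostLaw, (h.congr hae).map_eq]
  congr 1
  · ring
  · refine NNReal.eq ?_
    have h3 : 0 ≤ T ^ 3 / 3 := by positivity
    rw [Real.coe_toNNReal _ (mul_nonneg (sq_nonneg _) h3), NNReal.coe_mul,
      Real.coe_toNNReal _ h3]
    rfl

/-! ### The sensitivities of the means -/

lemma hasDerivAt_rpow_div {y θ : ℝ} (hy : 0 < y) (hθ : 0 < θ) :
    HasDerivAt (fun η => y ^ η / η) (-(y ^ θ * (1 - θ * Real.log y) / θ ^ 2)) θ := by
  refine ((Real.hasStrictDerivAt_const_rpow hy θ).hasDerivAt.div (hasDerivAt_id θ)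
    hθ.ne').congr_deriv ?_
  simp only [id]
  ring

lemma hasDerivAt_mul_rpow_div {y θ : ℝ} (hy : 0 < y) (hθ : 0 < θ) :
    HasDerivAt (fun η => y * y ^ η / (η * (η + 1)))
      (-(y * y ^ θ * ((1 + θ) * (1 - θ * Real.log y) + θ) / (θ ^ 2 * (1 + θ) ^ 2))) θ := by
  have h : HasDerivAt (fun η : ℝ => η * (η + 1)) (1 * (θ + 1) + θ * 1) θ :=
    (hasDerivAt_id θ).mul ((hasDerivAt_id θ).add_const 1)
  have h1 : θ + 1 ≠ 0 := by linarith
  refine (((Real.hasStrictDerivAt_const_rpow hy θ).hasDerivAt.const_mul y).div h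
    (mul_ne_zero hθ.ne' h1)).congr_deriv ?_
  field_simp
  ring

/-- The Fisher information about the decay exponent in the cost is at most that in the prices at
an early time and at the end of the execution. -/
lemma cost_info_le_price_info (c : ℝ) {σ δ v T t : ℝ} (hσ : 0 < σ) (hδ : 0 < δ) (hδ' : δ ≤ 0.8)
    (hv : 0 < v) (hT : 0 < T) (hvT : v * T ≤ 1) (ht₁ : 0.012 ≤ t / T) (ht₂ : t / T ≤ 0.222) :
    (c * -(v * T * (v * T) ^ δ * ((1 + δ) * (1 - δ * Real.log (v * T)) + δ)
        / (δ ^ 2 * (1 + δ) ^ 2))) ^ 2 / ((v * σ) ^ 2 * (T ^ 3 / 3)) ≤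
      (c * -((v * t) ^ δ * (1 - δ * Real.log (v * t)) / δ ^ 2)) ^ 2 / (σ ^ 2 * t) +
      (c * (-((v * T) ^ δ * (1 - δ * Real.log (v * T)) / δ ^ 2)
        - -((v * t) ^ δ * (1 - δ * Real.log (v * t)) / δ ^ 2))) ^ 2 / (σ ^ 2 * (T - t)) := by
  set τ := t / T with hτ
  have ht : t = τ * T := by rw [hτ]; field_simp
  have hτ0 : 0 < τ := by linarith
  have hτ1 : 0 < 1 - τ := by linarith
  set A := 1 - δ * Real.log (v * T) with hA
  have hA0 : 0 ≤ A := by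
    have := Real.log_nonpos (by positivity) hvT
    nlinarith
  have hvt : v * t = τ * (v * T) := by rw [ht]; ring
  have hlog : 1 - δ * Real.log (v * t) = A - δ * Real.log τ := by
    rw [hvt, Real.log_mul hτ0.ne' (by positivity)]; ring
  have hpow : (v * t) ^ δ = τ ^ δ * (v * T) ^ δ := by
    rw [hvt, Real.mul_rpow hτ0.le (by positivity)]
  -- The multiplier is the factor shared by all three terms; the `3` in the normalised inequality
  -- comes from the variance `T^3 / 3`.
  have key := mul_le_mul_of_nonneg_left (normalized_info_le ht₁ ht₂ hδ hδ' hA0)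
    (by positivity : 0 ≤ (c * (v * T) ^ δ / δ ^ 2) ^ 2 / (σ ^ 2 * T))
  rw [hlog, hpow, ht]
  have hTt : T - τ * T = (1 - τ) * T := by ring
  rw [hTt]
  have hδ1 : 1 + δ ≠ 0 := by linarith
  generalize τ ^ δ = w at key ⊢
  generalize (v * T) ^ δ = X at key ⊢
  generalize Real.log τ = r at key ⊢
  clear_value A τ
  refine le_of_eq_of_le ?_ (key.trans_eq ?_)
  · field_simp
  · have := hτ1.ne'
    field_simp
    ring

theorem corollary3 {Ω : Type*} [MeasurableSpace Ω] (P : Measure Ω) (W : ℝ≥0 → Ω → ℝ)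
    (hW : IsBrownianReal W P)
    (a b S₀ σ : ℝ) (hσ : 0 < σ)
    (Θ : Set ℝ) (hΘ : IsOpen Θ) (hΘpos : Θ ⊆ Set.Ioi 0)
    (δ : ℝ) (hδΘ : δ ∈ Θ) (hδ : δ ≤ 0.8)
    (v T : ℝ) (hv : 0 < v) (hT : 0 < T) (hvT₁ : 0.005 ≤ v * T) (hvT₂ : v * T ≤ 1)
    (t : ℝ) (ht₁ : 0.012 ≤ t / T) (ht₂ : t / T ≤ 0.222) :
    ∃ I_S I_J : ℝ,
      HasFisherInfo Θ (pricePairLaw P a b v T S₀ σ W t) δ I_S ∧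
      HasFisherInfo Θ (vwapCostLaw P a b v T S₀ σ W) δ I_J ∧
      I_J ≤ I_S := by
  have ht : 0 < t := by
    have : 0 < t / T := by linarith
    exact (div_pos_iff_of_pos_right hT).1 this
  have htT : t < T := by
    have : t / T < 1 := by linarith
    exact (div_lt_one hT).1 this
  have hδ0 : 0 < δ := hΘpos hδΘ
  have hvt : 0 < v * t := mul_pos hv ht
  have hvT : 0 < v * T := mul_pos hv hT
  have hV₁ : 0 < σ ^ 2 * t := by positivity
  have hV₂ : 0 < σ ^ 2 * (T - t) := mul_pos (by positivity) (sub_pos.2 htT)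
  have hV₃ : 0 < (v * σ) ^ 2 * (T ^ 3 / 3) := by positivity
  have hm (θ : ℝ) (hθ : θ ∈ Θ) := (((hasDerivAt_rpow_div hvt (hΘpos hθ)).const_mul
    (a * b)).const_add S₀)
  have hd (θ : ℝ) (hθ : θ ∈ Θ) := (((hasDerivAt_rpow_div hvT (hΘpos hθ)).sub
    (hasDerivAt_rpow_div hvt (hΘpos hθ))).const_mul (a * b))
  have hk (θ : ℝ) (hθ : θ ∈ Θ) := (hasDerivAt_mul_rpow_div hvT (hΘpos hθ)).const_mul (a * b)
  refine ⟨_, _, hasFisherInfo_gaussianCumulLaw hΘ (Real.toNNReal_pos.2 hV₁).ne'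
    (Real.toNNReal_pos.2 hV₂).ne'
    (fun θ hθ => pricePairLaw_eq hW a b S₀ σ (hΘpos hθ) hv ht.le htT.le)
    (fun θ hθ => (hm θ hθ).differentiableAt) (fun θ hθ => (hd θ hθ).differentiableAt)
    hδΘ (hm δ hδΘ) (hd δ hδΘ),
    hasFisherInfo_gaussianReal hΘ (Real.toNNReal_pos.2 hV₃).ne'
    (fun θ hθ => vwapCostLaw_eq hW a b S₀ σ (hΘpos hθ) hv hT)
    (fun θ hθ => (hk θ hθ).differentiableAt) hδΘ (hk δ hδΘ), ?_⟩
  rw [Real.coe_toNNReal _ hV₁.le, Real.coe_toNNReal _ hV₂.le, Real.coe_toNNReal _ hV₃.le]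
  exact cost_info_le_price_info (a * b) hσ hδ0 hδ hv hT hvT₂ ht₁ ht₂
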